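/- Let $0<q<1$ and let $\nu>-1$ be real with $\nu\notin\{0,1,2,\dots\}$. Write $(a;p)_n=\prod_{k=0}^{n-1}(1-ap^k)$, $(a;p)_\infty=\prod_{k\ge 0}(1-ap^k)$, $$j_\alpha(x,q^2)=\sum_{n\ge 0}(-1)^n\frac{q^{n(n+1)}}{(q^2;q^2)_n(q^{2\alpha+2};q^2)_n}x^{2n},\qquad I_\alpha(x,q^2)=j_\alpha(ix,q^2)\quad(\alpha=\pm\nu),$$ and let the polynomials $P_n$ ($q^{-1}$-Lommel polynomials) be given by $P_{-1}=0$, $P_0=1$ and $$q^{2n+\nu+1}P_{n+1}(x)-q^{2n}(1+q^{2\nu})P_n(x)+q^{2n+\nu-1}P_{n-1}(x)=x\,P_n(x),\qquad n\ge 0.$$ There is exactly one positive Borel measure $\mu$ on $\mathbb R$ with respect to which $(P_n)_{n\ge0}$ is orthonormal. Let $z\in\mathbb C\setminus\operatorname{supp}\mu$ and let $\sqrt z$ be either square root of $z$. Then $t\mapsto 1/(z-t)$ is $\mu$-integrable, the number $$D_\nu(\sqrt z)=q^{-2\nu}I_{-\nu}(q^{1-\nu}\sqrt z,q^2)(-z^{-1};q^2)_\infty(-q^2z;q^2)_\infty-\sigma_\nu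 I_\nu(q\sqrt z,q^2)(-q^{2\nu}z^{-1};q^2)_\infty(-q^{2-2\nu}z;q^2)_\infty,\qquad \sigma_\nu=\frac{(q^{2\nu+2};q^2)_\infty}{(q^{2-2\nu};q^2)_\infty},$$ is nonzero, and $$\int_{\mathbb R}\frac{d\mu(t)}{z-t}=\frac{1}{q^{2\nu}I_\nu(q\sqrt z,q^2)}\left[I_\nu(\sqrt z,q^2)-\frac{(q^{-2\nu}-1)(-z^{-1};q^2)_\infty(-q^2z;q^2)_\infty}{D_\nu(\sqrt z)}\right]$$ whenever $I_\nu(q\sqrt z,q^2)\ne0$. At the points $z\notin\operatorname{supp}\mu$ where $I_\nu(q\sqrt z,q^2)=0$ the right-hand side, as a function of $\sqrt z$, has a removable singularity, and the formula holds with its limit there. -/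

import Mathlib

open MeasureTheory Filter Topology

/-- The finite `q`-shifted factorial `(a;p)_n = ∏_{k<n} (1 - a p^k)`. -/
noncomputable def qPoch (a p : ℂ) (n : ℕ) : ℂ :=
  ∏ k ∈ Finset.range n, (1 - a * p ^ k)

/-- The infinite `q`-shifted factorial `(a;p)_∞ = ∏_{k≥0} (1 - a p^k)`
(used for `|p| < 1`, where the product converges absolutely). -/
noncomputable def qPochInf (a p : ℂ) : ℂ :=
  ∏' k : ℕ, (1 - a * p ^ k)

/-- The normalized third Jackson (Hahn-Exton) `q`-Bessel function with base `p`: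
`j_ν(x;p) = ∑_{n≥0} (-1)^n p^{n(n+1)/2} / ((p;p)_n (p^{ν+1};p)_n) x^{2n}`. -/
noncomputable def qBesselJ (ν p : ℝ) (x : ℂ) : ℂ :=
  ∑' n : ℕ, (-1) ^ n * (p : ℂ) ^ (n * (n + 1) / 2) /
    (qPoch (p : ℂ) (p : ℂ) n * qPoch ((p ^ (ν + 1) : ℝ) : ℂ) (p : ℂ) n) * x ^ (2 * n)

/-- The modified `q`-Bessel function `I_ν(x;p) = j_ν(ix;p)`. -/
noncomputable def qBesselI (ν p : ℝ) (x : ℂ) : ℂ :=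
  qBesselJ ν p (Complex.I * x)

/-- Off-diagonal recurrence coefficient `a_n = q^{2n+ν+1}`. -/
noncomputable def lommelA (q ν : ℝ) (n : ℕ) : ℝ :=
  q ^ (2 * (n : ℝ) + ν + 1)

/-- Diagonal recurrence coefficient `b_n = -q^{2n}(1+q^{2ν})`. -/
noncomputable def lommelB (q ν : ℝ) (n : ℕ) : ℝ :=
  -(q ^ (2 * n) * (1 + q ^ (2 * ν)))

/-- The `q⁻¹`-Lommel polynomials: `P_{-1} = 0`, `P_0 = 1` and
`a_n P_{n+1} + b_n P_n + a_{n-1} P_{n-1} = X P_n`. -/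
noncomputable def lommelP (q ν : ℝ) : ℕ → Polynomial ℝ
  | 0 => 1
  | 1 => Polynomial.C (lommelA q ν 0)⁻¹ * (Polynomial.X - Polynomial.C (lommelB q ν 0))
  | n + 2 => Polynomial.C (lommelA q ν (n + 1))⁻¹ *
      ((Polynomial.X - Polynomial.C (lommelB q ν (n + 1))) * lommelP q ν (n + 1)
        - Polynomial.C (lommelA q ν n) * lommelP q ν n)

/-- The three-term recurrence in evaluated form, for `n = 0` (with `P_{-1} = 0`). -/
theorem lommelP_rec_zero {q : ℝ} (hq : 0 < q) (ν x : ℝ) :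
    q ^ (ν + 1) * (lommelP q ν 1).eval x - (1 + q ^ (2 * ν)) * (lommelP q ν 0).eval x
      = x * (lommelP q ν 0).eval x := by
  have h : q ^ (ν + 1) ≠ 0 := (Real.rpow_pos_of_pos hq _).ne'
  simp [lommelP, lommelA, lommelB]
  field_simp
  ring

/-- The three-term recurrence in evaluated form, at the index `n + 1`. -/
theorem lommelP_rec_succ {q : ℝ} (hq : 0 < q) (ν x : ℝ) (n : ℕ) :
    q ^ (2 * ((n : ℝ) + 1) + ν + 1) * (lommelP q ν (n + 2)).eval x
      - q ^ (2 * (n + 1)) * (1 + q ^ (2 * ν)) * (lommelP q ν (n + 1)).eval x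
      + q ^ (2 * ((n : ℝ) + 1) + ν - 1) * (lommelP q ν n).eval x
      = x * (lommelP q ν (n + 1)).eval x := by
  have h : q ^ (2 * ((n : ℝ) + 1) + ν + 1) ≠ 0 := (Real.rpow_pos_of_pos hq _).ne'
  have e : 2 * ((n : ℝ) + 1) + ν - 1 = 2 * (n : ℝ) + ν + 1 := by ring
  rw [e]
  simp only [lommelP, lommelA, lommelB, Polynomial.eval_mul, Polynomial.eval_sub,
    Polynomial.eval_C, Polynomial.eval_X, Nat.cast_add, Nat.cast_one]
  field_simp
  ring

/-- `μ` is an orthogonality measure of `(P_n)`: a positive Borel measure on `ℝ` for which all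
products `P_n P_m` are integrable and `(P_n)` is orthonormal. -/
structure IsLommelOrthogonalityMeasure (q ν : ℝ) (μ : Measure ℝ) : Prop where
  integrable : ∀ n m : ℕ,
    Integrable (fun t : ℝ => (lommelP q ν n).eval t * (lommelP q ν m).eval t) μ
  orthonormal : ∀ n m : ℕ,
    ∫ t, (lommelP q ν n).eval t * (lommelP q ν m).eval t ∂μ = if n = m then 1 else 0

/-- `σ_ν = (q^{2ν+2};q²)_∞ / (q^{-2ν+2};q²)_∞`. -/
noncomputable def lommelSigma (q ν : ℝ) : ℂ :=
  qPochInf ((q ^ (2 * ν + 2) : ℝ) : ℂ) ((q : ℂ) ^ 2) /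
    qPochInf ((q ^ (-2 * ν + 2) : ℝ) : ℂ) ((q : ℂ) ^ 2)

/-- `(-z⁻¹;q²)_∞ (-q² z;q²)_∞`. -/
noncomputable def lommelTheta (q : ℝ) (z : ℂ) : ℂ :=
  qPochInf (-z⁻¹) ((q : ℂ) ^ 2) * qPochInf (-((q : ℂ) ^ 2 * z)) ((q : ℂ) ^ 2)

/-- The inner denominator, for a square root `s` of `z`:
`q^{-2ν} I_{-ν}(q^{1-ν}s;q²) (-z⁻¹;q²)_∞ (-q²z;q²)_∞
  - σ_ν I_ν(qs;q²) (-q^{2ν}z⁻¹;q²)_∞ (-q^{2-2ν}z;q²)_∞`. -/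
noncomputable def lommelDenom (q ν : ℝ) (z s : ℂ) : ℂ :=
  ((q ^ (-2 * ν) : ℝ) : ℂ) * qBesselI (-ν) (q ^ 2) (((q ^ (1 - ν) : ℝ) : ℂ) * s) * lommelTheta q z
    - lommelSigma q ν * qBesselI ν (q ^ 2) ((q : ℂ) * s) *
      (qPochInf (-(((q ^ (2 * ν) : ℝ) : ℂ) * z⁻¹)) ((q : ℂ) ^ 2) *
        qPochInf (-(((q ^ (2 - 2 * ν) : ℝ) : ℂ) * z)) ((q : ℂ) ^ 2))

/-- The closed form of the Stieltjes transform, for a square root `s` of `z`. -/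
noncomputable def lommelStieltjes (q ν : ℝ) (z s : ℂ) : ℂ :=
  1 / (((q ^ (2 * ν) : ℝ) : ℂ) * qBesselI ν (q ^ 2) ((q : ℂ) * s)) *
    (qBesselI ν (q ^ 2) s
      - (((q ^ (-2 * ν) : ℝ) : ℂ) - 1) * lommelTheta q z / lommelDenom q ν z s)

/-! Put p = q² and c = q^ν. The recurrence coefficients are summable, so the Jacobi matrix is a
bounded self-adjoint operator, and its spectral measure at the first basis vector is an
orthogonality measure. Any other one has the same moments, hence bounded support, and Weierstrass
approximation identifies the two (`existsUnique_lommel_measure`).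

The transform is φ_0, where φ_n(z) = ∫ P_n(t)/(z - t) dμ(t). Off the support, φ_n is bounded in n
(`norm_lommelPhi_le`) and solves the recurrence of P_n, provided φ_{-1} = q/c. Also z ≠ 0, because 0
lies in the support. The recurrence is the q-difference equation of F_b = `qBesselSeries q b` read
along p^{1-n}z, so it has the solutions U_n = (qc)^{-n} F_{pc²}(p^{1-n}z) and W_n = (c/q)^n
F_{p/c²}(p^{1-n}z/c²), independent by `qBesselSeries_wronskian`. Write φ_{n-1} = αU_n + βW_n.
Multiplied by (c/z)^n q^{n²}, the left side at n + 1 tends to 0 while U_{n+1} and W_{n+1} tend to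
multiples of theta products (`tendsto_qBesselSeries_theta`). This gives one linear relation between
α and β; the value φ_{-1} gives another.

Up to a factor the determinant of these two equations is D_ν. It is nonzero because φ_{-1} ≠ 0 and
the two theta products have no common zero (`lommelTheta_ne_zero_or`). Solving for φ_0 and inserting
the Wronskian gives the closed form (`bounded_lommel_solution`). At zeros of I_ν(q√z), which are
isolated, continuity of the transform gives the limit. -/

/-! ### Spectral measures of bounded self-adjoint operators -/

section SpectralMeasure

open scoped InnerProductSpace

variable {H : Type*} [NormedAddCommGroup H] [InnerProductSpace ℂ H] [CompleteSpace H]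

/-- The positive functional `f ↦ re ⟪x, f(T) x⟫` on continuous functions on the spectrum. -/
noncomputable def spectralFunctional (T : H →L[ℂ] H) (hT : IsSelfAdjoint T) (x : H) :
    CompactlySupportedContinuousMap (spectrum ℝ T) ℝ →ₚ[ℝ] ℝ where
  toFun f := RCLike.re (inner ℂ x (cfcHom hT (f : C(spectrum ℝ T, ℝ)) x))
  map_add' f g := by
    have : ((f + g : CompactlySupportedContinuousMap (spectrum ℝ T) ℝ) : C(spectrum ℝ T, ℝ))
        = f + g := rfl
    rw [this, map_add]
    simp
  map_smul' r f := by
    have : ((r • f : CompactlySupportedContinuousMap (spectrum ℝ T) ℝ) : C(spectrum ℝ T, ℝ))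
        = r • (f : C(spectrum ℝ T, ℝ)) := rfl
    rw [this, map_smul]
    simp [inner_smul_right_eq_smul]
  monotone' := by
    intro f g hfg
    have h1 : (f : C(spectrum ℝ T, ℝ)) ≤ g := hfg
    have h2 := cfcHom_mono hT h1
    have h3 := (ContinuousLinearMap.le_def _ _).1 h2
    have h4 := h3.re_inner_nonneg_right x
    simp only [sub_apply, inner_sub_right, map_sub] at h4
    simpa using h4

/-- Riesz-Markov on the spectrum, pushed forward to ℝ. Compactness of the spectrum makes the measure
finite and boundedly supported, and the continuous functional calculus agrees with
`Polynomial.aeval` on polynomials. -/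
theorem exists_spectral_measure (T : H →L[ℂ] H) (hT : IsSelfAdjoint T) (x : H) :
    ∃ μ : Measure ℝ, IsFiniteMeasure μ ∧ (∃ R : ℝ, ∀ᵐ t ∂μ, |t| ≤ R) ∧
      ∀ P : Polynomial ℝ, ∫ t, P.eval t ∂μ = RCLike.re (inner ℂ x (Polynomial.aeval T P x)) := by
  have : CompactSpace (spectrum ℝ T) :=
    isCompact_iff_compactSpace.1 (ContinuousFunctionalCalculus.isCompact_spectrum (R := ℝ) T)
  set m := RealRMK.rieszMeasure (spectralFunctional T hT x) with hm
  have hval : Measurable (Subtype.val : spectrum ℝ T → ℝ) := measurable_subtype_coe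
  have hfin : IsFiniteMeasure m := inferInstance
  obtain ⟨R, hR⟩ := (ContinuousFunctionalCalculus.isCompact_spectrum (R := ℝ) T).isBounded
    |>.exists_norm_le
  refine ⟨m.map Subtype.val, inferInstance, ⟨R, ?_⟩, fun P => ?_⟩
  · rw [ae_map_iff hval.aemeasurable (measurableSet_le (by fun_prop) (by fun_prop))]
    exact Eventually.of_forall fun t => hR t t.2
  · rw [integral_map hval.aemeasurable P.continuous.aestronglyMeasurable]
    let f : C(spectrum ℝ T, ℝ) := ⟨fun t => P.eval t.1, by fun_prop⟩
    have h := RealRMK.integral_rieszMeasure (spectralFunctional T hT x)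
      (CompactlySupportedContinuousMap.continuousMapEquiv f)
    refine h.trans ?_
    change RCLike.re (inner ℂ x (cfcHom hT f x)) = _
    have hf : f = Polynomial.aeval ((ContinuousMap.id ℝ).restrict (spectrum ℝ T)) P := by
      ext t
      simp [f, Polynomial.aeval_continuousMap_apply]
    have h2 : cfcHom hT f = Polynomial.aeval T P := by
      rw [hf]
      have h3 := Polynomial.aeval_algHom_apply (cfcHom hT : C(spectrum ℝ T, ℝ) →⋆ₐ[ℝ] _)
        ((ContinuousMap.id ℝ).restrict (spectrum ℝ T)) P
      rw [cfcHom_id hT] at h3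
      exact h3.symm
    rw [h2]

end SpectralMeasure

/-! ### Bounded Jacobi operators -/

section JacobiOperator

open scoped InnerProductSpace
open InnerProductSpace

variable {H : Type*} [NormedAddCommGroup H] [InnerProductSpace ℂ H] [CompleteSpace H]

/-- A Jacobi matrix with summable entries is realized by a bounded self-adjoint operator. -/
theorem exists_jacobi_operator {e : ℕ → H} (he : Orthonormal ℂ e) {a b : ℕ → ℝ}
    (ha : Summable fun n => |a n|) (hb : Summable fun n => |b n|) :
    ∃ T : H →L[ℂ] H, IsSelfAdjoint T ∧ T (e 0) = b 0 • e 0 + a 0 • e 1 ∧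
      ∀ n, T (e (n + 1)) = a n • e n + b (n + 1) • e (n + 1) + a (n + 1) • e (n + 2) := by
  -- The operator is a norm-convergent sum of rank-one pieces, each off-diagonal pair symmetrized so
  -- that every summand is self-adjoint.
  let A : ℕ → H →L[ℂ] H := fun n => a n • (rankOne ℂ (e (n + 1)) (e n) + rankOne ℂ (e n) (e (n + 1)))
  let B : ℕ → H →L[ℂ] H := fun n => b n • rankOne ℂ (e n) (e n)
  have hinner := orthonormal_iff_ite.1 he
  have hA : Summable A := by
    refine Summable.of_norm_bounded (g := fun n => |a n| * 2) (ha.mul_right 2) fun n => ?_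
    rw [norm_smul, Real.norm_eq_abs]
    refine mul_le_mul_of_nonneg_left ((norm_add_le _ _).trans ?_) (abs_nonneg _)
    simp [norm_rankOne, he.1]
    norm_num
  have hB : Summable B := by
    refine Summable.of_norm_bounded (g := fun n => |b n|) hb fun n => ?_
    simp [B, norm_smul, norm_rankOne, he.1]
  have hAs : IsSelfAdjoint (∑' n, A n) := by
    rw [IsSelfAdjoint, tsum_star]
    refine tsum_congr fun n => ?_
    simp [A, ContinuousLinearMap.star_eq_adjoint, add_comm]
  have hBs : IsSelfAdjoint (∑' n, B n) := by
    rw [IsSelfAdjoint, tsum_star]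
    refine tsum_congr fun n => ?_
    simp [B, ContinuousLinearMap.star_eq_adjoint]
  have hAe : ∀ x, (∑' n, A n) x = ∑' n, A n x := fun x =>
    ((ContinuousLinearMap.apply ℂ H x).hasSum hA.hasSum).tsum_eq.symm
  have hBe : ∀ x, (∑' n, B n) x = ∑' n, B n x := fun x =>
    ((ContinuousLinearMap.apply ℂ H x).hasSum hB.hasSum).tsum_eq.symm
  have hBk : ∀ k, (∑' n, B n) (e k) = b k • e k := fun k => by
    rw [hBe, tsum_eq_single k]
    · simp [B, he.1]
    · intro n hn
      simp [B, hinner, hn]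
  refine ⟨∑' n, A n + ∑' n, B n, hAs.add hBs, ?_, fun k => ?_⟩
  · rw [add_apply, hBk, hAe, tsum_eq_single 0]
    · simp [A, hinner, he.1, add_comm]
    · intro n hn
      simp [A, hinner, hn]
  · rw [add_apply, hBk, hAe, tsum_eq_sum (s := {k, k + 1})]
    · rw [Finset.sum_pair (by simp)]
      simp [A, hinner, he.1]
      abel
    · intro n hn
      simp only [Finset.mem_insert, Finset.mem_singleton, not_or] at hn
      simp [A, hinner, hn.1, hn.2]

end JacobiOperator

/-! ### Recurrence coefficients and existence of an orthogonality measure -/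

theorem lommelA_pos {q : ℝ} (hq : 0 < q) (ν : ℝ) (n : ℕ) : 0 < lommelA q ν n :=
  Real.rpow_pos_of_pos hq _

theorem lommelA_eq {q : ℝ} (hq : 0 < q) (ν : ℝ) (n : ℕ) :
    lommelA q ν n = q ^ (2 * n + 1) * q ^ ν := by
  rw [lommelA, ← Real.rpow_natCast, ← Real.rpow_add hq]
  push_cast
  ring_nf

theorem lommelB_eq {q : ℝ} (hq : 0 < q) (ν : ℝ) (n : ℕ) :
    lommelB q ν n = -(q ^ (2 * n) * (1 + (q ^ ν) ^ 2)) := by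
  rw [lommelB, ← Real.rpow_natCast (q ^ ν), ← Real.rpow_mul hq.le]
  push_cast
  ring_nf

theorem summable_lommelA {q : ℝ} (hq0 : 0 < q) (hq1 : q < 1) (ν : ℝ) :
    Summable fun n => |lommelA q ν n| := by
  have h := summable_geometric_of_lt_one (sq_nonneg q) (by nlinarith : q ^ 2 < 1)
  refine (h.mul_right (q * q ^ ν)).congr fun n => ?_
  rw [abs_of_pos (lommelA_pos hq0 ν n), lommelA_eq hq0]
  ring

theorem summable_lommelB {q : ℝ} (hq0 : 0 < q) (hq1 : q < 1) (ν : ℝ) :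
    Summable fun n => |lommelB q ν n| := by
  have h := summable_geometric_of_lt_one (sq_nonneg q) (by nlinarith : q ^ 2 < 1)
  refine (h.mul_right (1 + (q ^ ν) ^ 2)).congr fun n => ?_
  rw [lommelB_eq hq0, abs_neg, abs_of_nonneg (by positivity)]
  ring

theorem X_mul_lommelP_zero {q : ℝ} (hq : 0 < q) (ν : ℝ) :
    Polynomial.X * lommelP q ν 0 =
      lommelB q ν 0 • lommelP q ν 0 + lommelA q ν 0 • lommelP q ν 1 := by
  have h := (lommelA_pos hq ν 0).ne'
  simp only [lommelP, Polynomial.smul_eq_C_mul]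
  rw [← mul_assoc, ← Polynomial.C_mul, mul_inv_cancel₀ h]
  simp

theorem X_mul_lommelP_succ {q : ℝ} (hq : 0 < q) (ν : ℝ) (n : ℕ) :
    Polynomial.X * lommelP q ν (n + 1) =
      lommelA q ν n • lommelP q ν n + lommelB q ν (n + 1) • lommelP q ν (n + 1)
        + lommelA q ν (n + 1) • lommelP q ν (n + 2) := by
  have h := (lommelA_pos hq ν (n + 1)).ne'
  rw [lommelP.eq_3, Polynomial.smul_eq_C_mul, Polynomial.smul_eq_C_mul, Polynomial.smul_eq_C_mul,
    ← mul_assoc (Polynomial.C _) (Polynomial.C _), ← Polynomial.C_mul, mul_inv_cancel₀ h]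
  simp
  ring

theorem isSelfAdjoint_aeval {A : Type*} [Ring A] [Algebra ℝ A] [StarRing A] [StarModule ℝ A]
    {T : A} (hT : IsSelfAdjoint T) (P : Polynomial ℝ) :
    IsSelfAdjoint (Polynomial.aeval T P) := by
  induction P using Polynomial.induction_on' with
  | add p r hp hr => rw [map_add]; exact hp.add hr
  | monomial n r =>
    rw [Polynomial.aeval_monomial, ← Algebra.smul_def]
    exact (IsSelfAdjoint.all r).smul (hT.pow n)

/-- The recurrence gives P_n(T)e_0 = e_n, so the spectral measure at e_0 satisfies ∫ P_n P_m =
⟨P_n(T)e_0, P_m(T)e_0⟩ = ⟨e_n, e_m⟩. -/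
theorem exists_lommel_measure_of_orthonormal {q : ℝ} (hq0 : 0 < q) (hq1 : q < 1) (ν : ℝ)
    {H : Type*} [NormedAddCommGroup H] [InnerProductSpace ℂ H] [CompleteSpace H] {e : ℕ → H}
    (he : Orthonormal ℂ e) :
    ∃ μ : Measure ℝ, IsLommelOrthogonalityMeasure q ν μ ∧ ∃ R : ℝ, ∀ᵐ t ∂μ, |t| ≤ R := by
  obtain ⟨T, hT, hT0, hT1⟩ := exists_jacobi_operator he (summable_lommelA hq0 hq1 ν)
    (summable_lommelB hq0 hq1 ν)
  obtain ⟨μ, hfin, ⟨R, hR⟩, hμ⟩ := exists_spectral_measure T hT (e 0)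
  have key : ∀ n, Polynomial.aeval T (lommelP q ν n) (e 0) = e n ∧
      Polynomial.aeval T (lommelP q ν (n + 1)) (e 0) = e (n + 1) := by
    intro n
    induction n with
    | zero =>
      have h0 : Polynomial.aeval T (lommelP q ν 0) (e 0) = e 0 := by simp [lommelP]
      refine ⟨h0, ?_⟩
      have h := congrArg (fun P => Polynomial.aeval T P (e 0)) (X_mul_lommelP_zero hq0 ν)
      simp only [map_mul, map_add, map_smul, Polynomial.aeval_X, mul_apply_eq_comp,
        add_apply, smul_apply, h0, hT0] at h
      have h2 := add_left_cancel h
      exact (smul_right_injective H (lommelA_pos hq0 ν 0).ne' h2).symm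
    | succ n ih =>
      refine ⟨ih.2, ?_⟩
      have h := congrArg (fun P => Polynomial.aeval T P (e 0)) (X_mul_lommelP_succ hq0 ν n)
      simp only [map_mul, map_add, map_smul, Polynomial.aeval_X, mul_apply_eq_comp,
        add_apply, smul_apply, ih.1, ih.2, hT1] at h
      have h2 := add_left_cancel h
      exact (smul_right_injective H (lommelA_pos hq0 ν (n + 1)).ne' h2).symm
  refine ⟨μ, ⟨fun n m => ?_, fun n m => ?_⟩, R, hR⟩
  · have hc : Continuous fun t : ℝ => (lommelP q ν n).eval t * (lommelP q ν m).eval t := by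
      fun_prop
    obtain ⟨C, hC⟩ := (isCompact_Icc (a := -R) (b := R)).exists_bound_of_continuousOn
      hc.continuousOn
    refine Integrable.of_bound hc.aestronglyMeasurable C ?_
    filter_upwards [hR] with t ht using hC t (abs_le.1 ht)
  · have h := hμ (lommelP q ν n * lommelP q ν m)
    simp only [Polynomial.eval_mul] at h
    rw [h, map_mul, mul_apply_eq_comp,
      ← ContinuousLinearMap.adjoint_inner_left, ← ContinuousLinearMap.star_eq_adjoint,
      (isSelfAdjoint_aeval hT _).star_eq, (key n).1, (key m).1, orthonormal_iff_ite.1 he]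
    split_ifs <;> simp

theorem exists_lommel_measure {q : ℝ} (hq0 : 0 < q) (hq1 : q < 1) (ν : ℝ) :
    ∃ μ : Measure ℝ, IsLommelOrthogonalityMeasure q ν μ ∧ ∃ R : ℝ, ∀ᵐ t ∂μ, |t| ≤ R :=
  exists_lommel_measure_of_orthonormal hq0 hq1 ν
    (HilbertBasis.ofRepr (LinearIsometryEquiv.refl ℂ (lp (fun _ : ℕ => ℂ) 2))).orthonormal

/-- The span contains 1 and is stable under multiplication by X. Hence orthonormality alone fixes
all moments. -/
theorem span_lommelP {q : ℝ} (hq : 0 < q) (ν : ℝ) :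
    Submodule.span ℝ (Set.range (lommelP q ν)) = ⊤ := by
  set S := Submodule.span ℝ (Set.range (lommelP q ν)) with hS
  have hmem : ∀ n, lommelP q ν n ∈ S := fun n => Submodule.subset_span ⟨n, rfl⟩
  have hX : ∀ P ∈ S, Polynomial.X * P ∈ S := by
    intro P hP
    induction hP using Submodule.span_induction with
    | mem x hx =>
      obtain ⟨n, rfl⟩ := hx
      cases n with
      | zero =>
        rw [X_mul_lommelP_zero hq]
        exact S.add_mem (S.smul_mem _ (hmem _)) (S.smul_mem _ (hmem _))
      | succ n =>
        rw [X_mul_lommelP_succ hq]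
        exact S.add_mem (S.add_mem (S.smul_mem _ (hmem _)) (S.smul_mem _ (hmem _)))
          (S.smul_mem _ (hmem _))
    | zero => simp
    | add x y _ _ hx hy => rw [mul_add]; exact S.add_mem hx hy
    | smul a x _ hx => rw [mul_smul_comm]; exact S.smul_mem _ hx
  have hpow : ∀ n, (Polynomial.X : Polynomial ℝ) ^ n ∈ S := by
    intro n
    induction n with
    | zero => simpa [lommelP] using hmem 0
    | succ n ih => rw [pow_succ']; exact hX _ ih
  rw [eq_top_iff]
  rintro P -
  rw [P.as_sum_range_C_mul_X_pow]
  refine S.sum_mem fun i _ => ?_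
  rw [← Polynomial.smul_eq_C_mul]
  exact S.smul_mem _ (hpow i)

/-! ### Moments and uniqueness of the measure -/

namespace IsLommelOrthogonalityMeasure

variable {q ν : ℝ} {μ : Measure ℝ}

theorem integrable_lommelP (h : IsLommelOrthogonalityMeasure q ν μ) (n : ℕ) :
    Integrable (fun t => (lommelP q ν n).eval t) μ := by
  simpa [lommelP] using h.integrable n 0

theorem integral_lommelP (h : IsLommelOrthogonalityMeasure q ν μ) (n : ℕ) :
    ∫ t, (lommelP q ν n).eval t ∂μ = if n = 0 then 1 else 0 := by
  simpa [lommelP] using h.orthonormal n 0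

theorem isProbabilityMeasure (h : IsLommelOrthogonalityMeasure q ν μ) :
    IsProbabilityMeasure μ := by
  have h1 := h.integral_lommelP 0
  have h2 := h.integrable_lommelP 0
  simp only [lommelP, Polynomial.eval_one, integral_const, smul_eq_mul, mul_one, if_true] at h1 h2
  have : IsFiniteMeasure μ := by
    have := (integrable_const_iff (μ := μ) (c := (1 : ℝ))).1 h2
    simpa [isFiniteMeasure_iff] using this
  refine ⟨?_⟩
  rw [measureReal_def] at h1
  rw [← ENNReal.ofReal_toReal (measure_ne_top μ _), h1, ENNReal.ofReal_one]

theorem integrable_polynomial (hq : 0 < q) (h : IsLommelOrthogonalityMeasure q ν μ)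
    (P : Polynomial ℝ) : Integrable (fun t => P.eval t) μ := by
  have hP : P ∈ Submodule.span ℝ (Set.range (lommelP q ν)) := by rw [span_lommelP hq]; trivial
  induction hP using Submodule.span_induction with
  | mem x hx => obtain ⟨n, rfl⟩ := hx; exact h.integrable_lommelP n
  | zero => simp
  | add x y _ _ hx hy => simp only [Polynomial.eval_add]; exact hx.add hy
  | smul a x _ hx => simp only [Polynomial.eval_smul, smul_eq_mul]; exact hx.const_mul a

theorem integral_polynomial_eq (hq : 0 < q) {μ' : Measure ℝ}
    (h : IsLommelOrthogonalityMeasure q ν μ) (h' : IsLommelOrthogonalityMeasure q ν μ')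
    (P : Polynomial ℝ) : ∫ t, P.eval t ∂μ = ∫ t, P.eval t ∂μ' := by
  have hP : P ∈ Submodule.span ℝ (Set.range (lommelP q ν)) := by rw [span_lommelP hq]; trivial
  induction hP using Submodule.span_induction with
  | mem x hx =>
    obtain ⟨n, rfl⟩ := hx
    rw [h.integral_lommelP, h'.integral_lommelP]
  | zero => simp
  | add x y _ _ hx hy =>
    simp only [Polynomial.eval_add]
    rw [integral_add (h.integrable_polynomial hq x) (h.integrable_polynomial hq y),
      integral_add (h'.integrable_polynomial hq x) (h'.integrable_polynomial hq y), hx, hy]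
  | smul a x _ hx =>
    simp only [Polynomial.eval_smul, smul_eq_mul, integral_const_mul, hx]

end IsLommelOrthogonalityMeasure

/-- Geometric growth of the even moments confines a measure to a bounded interval. -/
theorem ae_abs_le_of_moments_le {μ : Measure ℝ} [IsFiniteMeasure μ] {R C : ℝ} (hR : 0 < R)
    (hi : ∀ k : ℕ, Integrable (fun t : ℝ => t ^ (2 * k)) μ)
    (h : ∀ k : ℕ, ∫ t, t ^ (2 * k) ∂μ ≤ C * R ^ (2 * k)) : ∀ᵐ t ∂μ, |t| ≤ 2 * R := by
  have hmeas : MeasurableSet {t : ℝ | 2 * R < |t|} := measurableSet_lt (by fun_prop) (by fun_prop)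
  -- Markov's inequality for t^{2k}: the ratio R^{2k}/(2R)^{2k} is (1/4)^k, which tends to 0.
  have hk : ∀ k : ℕ, μ.real {t : ℝ | 2 * R < |t|} ≤ C * (1 / 4) ^ k := by
    intro k
    have h1 : μ.real {t : ℝ | 2 * R < |t|} * (2 * R) ^ (2 * k) ≤ ∫ t, t ^ (2 * k) ∂μ := by
      have hind : ∫ t, Set.indicator {t : ℝ | 2 * R < |t|} (fun _ => (2 * R) ^ (2 * k)) t ∂μ
          ≤ ∫ t, t ^ (2 * k) ∂μ := by
        refine integral_mono ((integrable_const _).indicator hmeas) (hi k) fun t => ?_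
        by_cases ht : t ∈ {t : ℝ | 2 * R < |t|}
        · simp only [Set.indicator_of_mem ht]
          rw [← Even.pow_abs ⟨k, two_mul k⟩ t]
          exact pow_le_pow_left₀ (by positivity) (le_of_lt ht) _
        · simp only [Set.indicator_of_notMem ht]
          rw [pow_mul]; positivity
      rwa [integral_indicator_const _ hmeas, smul_eq_mul] at hind
    have h2 := h1.trans (h k)
    have h3 : (2 * R) ^ (2 * k) = 4 ^ k * R ^ (2 * k) := by
      rw [mul_pow, pow_mul 2]; norm_num
    rw [h3, ← mul_assoc] at h2
    have h4 := le_of_mul_le_mul_right h2 (by positivity)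
    rw [one_div, inv_pow, ← div_eq_mul_inv, le_div_iff₀ (by positivity)]
    exact h4
  have hlim : Tendsto (fun k : ℕ => C * (1 / 4 : ℝ) ^ k) atTop (𝓝 (C * 0)) :=
    (tendsto_pow_atTop_nhds_zero_of_lt_one (by norm_num) (by norm_num)).const_mul C
  have h0 : μ.real {t : ℝ | 2 * R < |t|} = 0 :=
    le_antisymm (by simpa using ge_of_tendsto' hlim hk) measureReal_nonneg
  rw [ae_iff]
  have := (measureReal_eq_zero_iff (measure_ne_top μ _)).1 h0
  simpa using this

/-- Finite measures on a bounded interval are determined by their moments. -/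
theorem measure_eq_of_forall_integral_polynomial_eq {μ μ' : Measure ℝ} [IsFiniteMeasure μ]
    [IsFiniteMeasure μ'] {R : ℝ} (h : ∀ᵐ t ∂μ, |t| ≤ R) (h' : ∀ᵐ t ∂μ', |t| ≤ R)
    (hm : ∀ P : Polynomial ℝ, ∫ t, P.eval t ∂μ = ∫ t, P.eval t ∂μ') : μ = μ' := by
  refine ext_of_forall_integral_eq_of_IsFiniteMeasure fun f => ?_
  have key : ∀ (m : Measure ℝ) [IsFiniteMeasure m], (∀ᵐ t ∂m, |t| ≤ R) → ∀ (P : Polynomial ℝ)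
      (ε : ℝ), (∀ x ∈ Set.Icc (-R) R, |P.eval x - f x| < ε) →
      |∫ t, P.eval t ∂m - ∫ t, f t ∂m| ≤ ε * m.real Set.univ := by
    intro m _ hmR P ε hP
    have hPi : Integrable (fun t => P.eval t) m := by
      obtain ⟨C, hC⟩ := (isCompact_Icc (a := -R) (b := R)).exists_bound_of_continuousOn
        P.continuous.continuousOn
      refine Integrable.of_bound P.continuous.aestronglyMeasurable C ?_
      filter_upwards [hmR] with t ht using hC t (abs_le.1 ht)
    rw [← integral_sub hPi (BoundedContinuousFunction.integrable m f)]
    rw [← Real.norm_eq_abs]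
    refine norm_integral_le_of_norm_le_const ?_
    filter_upwards [hmR] with t ht using (hP t (abs_le.1 ht)).le
  refine eq_of_forall_dist_le fun ε hε => ?_
  set M := μ.real Set.univ + μ'.real Set.univ + 1 with hM
  have hMpos : 0 < M := by positivity
  obtain ⟨P, hP⟩ := exists_polynomial_near_of_continuousOn (-R) R f f.continuous.continuousOn
    (ε / M) (by positivity)
  have h1 := key μ h P _ hP
  have h2 := key μ' h' P _ hP
  rw [hm P] at h1
  have h3 : ε / M * μ.real Set.univ + ε / M * μ'.real Set.univ ≤ ε := by
    rw [← mul_add, div_mul_eq_mul_div, div_le_iff₀ hMpos]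
    nlinarith
  rw [Real.dist_eq]
  rw [abs_le] at *
  constructor <;> linarith [h1.1, h1.2, h2.1, h2.2]

theorem existsUnique_lommel_measure {q : ℝ} (hq0 : 0 < q) (hq1 : q < 1) (ν : ℝ) :
    ∃! μ : Measure ℝ, IsLommelOrthogonalityMeasure q ν μ := by
  obtain ⟨μ, hμ, R, hR⟩ := exists_lommel_measure hq0 hq1 ν
  refine ⟨μ, hμ, fun μ' hμ' => ?_⟩
  have := hμ.isProbabilityMeasure
  have := hμ'.isProbabilityMeasure
  set S := max R 1 with hS
  have hS1 : 0 < S := lt_of_lt_of_le one_pos (le_max_right _ _)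
  have hRS : ∀ᵐ t ∂μ, |t| ≤ S := by
    filter_upwards [hR] with t ht using ht.trans (le_max_left _ _)
  -- No support bound is assumed for `μ'`; it is inherited from `μ` through the even moments.
  have hint : ∀ k : ℕ, ∫ t, t ^ (2 * k) ∂μ' = ∫ t, t ^ (2 * k) ∂μ := fun k => by
    simpa using hμ'.integral_polynomial_eq hq0 hμ (Polynomial.X ^ (2 * k))
  have hS' : ∀ᵐ t ∂μ', |t| ≤ 2 * S := by
    refine ae_abs_le_of_moments_le (C := 1) hS1 (fun k => ?_) fun k => ?_
    · simpa using hμ'.integrable_polynomial hq0 (Polynomial.X ^ (2 * k))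
    · rw [hint k]
      have hi : Integrable (fun t : ℝ => t ^ (2 * k)) μ := by
        simpa using hμ.integrable_polynomial hq0 (Polynomial.X ^ (2 * k))
      have := integral_mono_ae hi (integrable_const (S ^ (2 * k))) (by
        filter_upwards [hRS] with t ht
        rw [← Even.pow_abs ⟨k, two_mul k⟩ t]
        exact pow_le_pow_left₀ (abs_nonneg t) ht _)
      simpa using this
  refine measure_eq_of_forall_integral_polynomial_eq hS' ?_ (hμ'.integral_polynomial_eq hq0 hμ)
  filter_upwards [hRS] with t ht
  linarith

/-! ### Functions of the second kind and the support -/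

theorem integral_linear_combination_three {𝕜 α : Type*} [RCLike 𝕜] [MeasurableSpace α]
    {μ : Measure α} {f g h : α → 𝕜} (a b c : 𝕜) (hf : Integrable f μ) (hg : Integrable g μ)
    (hh : Integrable h μ) :
    ∫ t, (a * f t + b * g t + c * h t) ∂μ =
      a * ∫ t, f t ∂μ + b * ∫ t, g t ∂μ + c * ∫ t, h t ∂μ := by
  have h1 : Integrable (fun t => a * f t + b * g t) μ := (hf.const_mul a).add (hg.const_mul b)
  rw [integral_add h1 (hh.const_mul c), integral_add (hf.const_mul a) (hg.const_mul b),
    integral_const_mul, integral_const_mul, integral_const_mul]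

theorem exists_pos_le_norm_sub_of_notMem_support {μ : Measure ℝ} {z : ℂ}
    (hz : z ∉ (fun t : ℝ => (t : ℂ)) '' μ.support) :
    ∃ δ > 0, ∀ᵐ t ∂μ, δ ≤ ‖z - ((t : ℝ) : ℂ)‖ := by
  have hcl : IsClosed ((fun t : ℝ => (t : ℂ)) '' μ.support) :=
    Complex.isometry_ofReal.isClosedEmbedding.isClosedMap _ Measure.isClosed_support
  obtain ⟨δ, hδ, hball⟩ := Metric.isOpen_iff.1 hcl.isOpen_compl z hz
  refine ⟨δ, hδ, ?_⟩
  filter_upwards [Measure.support_mem_ae (μ := μ)] with t ht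
  by_contra! hlt
  refine hball (a := (t : ℂ)) ?_ ⟨t, ht, rfl⟩
  rwa [Metric.mem_ball, dist_comm, Complex.dist_eq]

/-- The functions of the second kind `φ_n(z) = ∫ P_n(t) / (z - t) dμ(t)`. -/
noncomputable def lommelPhi (q ν : ℝ) (μ : Measure ℝ) (z : ℂ) (n : ℕ) : ℂ :=
  ∫ t : ℝ, (((lommelP q ν n).eval t : ℝ) : ℂ) * (z - (t : ℂ))⁻¹ ∂μ

namespace IsLommelOrthogonalityMeasure

variable {q ν : ℝ} {μ : Measure ℝ}

theorem integrable_mul_inv_sub {z : ℂ} {δ : ℝ} (hδ : 0 < δ)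
    (hz : ∀ᵐ t ∂μ, δ ≤ ‖z - ((t : ℝ) : ℂ)‖) {f : ℝ → ℝ} (hf : Integrable f μ) :
    Integrable (fun t : ℝ => (f t : ℂ) * (z - (t : ℂ))⁻¹) μ := by
  refine hf.ofReal.mul_bdd (c := δ⁻¹) ?_ ?_
  · exact (by fun_prop : Measurable fun t : ℝ => (z - (t : ℂ))⁻¹).aestronglyMeasurable
  · filter_upwards [hz] with t ht
    rw [norm_inv]
    exact inv_anti₀ hδ ht

/-- From |P_n| ≤ (1 + P_n²)/2, whose integral is 1. Uniformity in n is what later singles out the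
right solution of the recurrence. -/
theorem norm_lommelPhi_le (h : IsLommelOrthogonalityMeasure q ν μ) {z : ℂ} {δ : ℝ} (hδ : 0 < δ)
    (hz : ∀ᵐ t ∂μ, δ ≤ ‖z - ((t : ℝ) : ℂ)‖) (n : ℕ) : ‖lommelPhi q ν μ z n‖ ≤ δ⁻¹ := by
  have := h.isProbabilityMeasure
  have hi := h.integrable n n
  have hn := h.orthonormal n n
  rw [if_pos rfl] at hn
  have hint : Integrable (fun t : ℝ => (1 + (lommelP q ν n).eval t * (lommelP q ν n).eval t) / 2
      * δ⁻¹) μ := (((integrable_const 1).add hi).div_const 2).mul_const _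
  refine (norm_integral_le_of_norm_le hint ?_).trans ?_
  · filter_upwards [hz] with t ht
    rw [norm_mul, norm_inv, Complex.norm_real, Real.norm_eq_abs]
    refine mul_le_mul ?_ (inv_anti₀ hδ ht) (by positivity)
      (by linarith [mul_self_nonneg ((lommelP q ν n).eval t)])
    rw [← abs_mul_abs_self]
    nlinarith [sq_nonneg (|(lommelP q ν n).eval t| - 1)]
  · rw [integral_mul_const, integral_div, integral_add (integrable_const 1) hi, hn]
    simp

/-- Integrate t/(z - t) = z/(z - t) - 1 against P. For P = P_n the last term vanishes by
orthogonality unless n = 0. -/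
theorem lommelPhi_rec (hq : 0 < q) (h : IsLommelOrthogonalityMeasure q ν μ) {z : ℂ} {δ : ℝ}
    (hδ : 0 < δ) (hz : ∀ᵐ t ∂μ, δ ≤ ‖z - ((t : ℝ) : ℂ)‖) (P : Polynomial ℝ) :
    ∫ t : ℝ, (((Polynomial.X * P).eval t : ℝ) : ℂ) * (z - (t : ℂ))⁻¹ ∂μ =
      z * ∫ t : ℝ, ((P.eval t : ℝ) : ℂ) * (z - (t : ℂ))⁻¹ ∂μ - ((∫ t, P.eval t ∂μ : ℝ) : ℂ) := by
  have hP := h.integrable_polynomial hq P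
  have hPc : Integrable (fun t => ((P.eval t : ℝ) : ℂ)) μ := hP.ofReal
  have hof : ((∫ t, P.eval t ∂μ : ℝ) : ℂ) = ∫ t, ((P.eval t : ℝ) : ℂ) ∂μ := integral_ofReal.symm
  rw [← integral_const_mul, hof,
    ← integral_sub ((integrable_mul_inv_sub hδ hz hP).const_mul z) hPc]
  refine integral_congr_ae ?_
  filter_upwards [hz] with t ht
  have hne : z - (t : ℂ) ≠ 0 := norm_pos_iff.1 (hδ.trans_le ht)
  simp
  field_simp
  ring

theorem lommelPhi_rec_zero (hq : 0 < q) (h : IsLommelOrthogonalityMeasure q ν μ) {z : ℂ} {δ : ℝ}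
    (hδ : 0 < δ) (hz : ∀ᵐ t ∂μ, δ ≤ ‖z - ((t : ℝ) : ℂ)‖) :
    lommelB q ν 0 * lommelPhi q ν μ z 0 + lommelA q ν 0 * lommelPhi q ν μ z 1 =
      z * lommelPhi q ν μ z 0 - 1 := by
  have hr := lommelPhi_rec hq h hδ hz (lommelP q ν 0)
  rw [h.integral_lommelP, if_pos rfl, X_mul_lommelP_zero hq] at hr
  simp only [Polynomial.eval_add, Polynomial.eval_smul, smul_eq_mul, Complex.ofReal_add,
    Complex.ofReal_mul, add_mul, mul_assoc] at hr
  have hI := fun n => integrable_mul_inv_sub hδ hz (h.integrable_lommelP n)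
  rw [integral_add ((hI _).const_mul _) ((hI _).const_mul _), integral_const_mul,
    integral_const_mul] at hr
  simpa [lommelPhi] using hr

theorem lommelPhi_rec_succ (hq : 0 < q) (h : IsLommelOrthogonalityMeasure q ν μ) {z : ℂ} {δ : ℝ}
    (hδ : 0 < δ) (hz : ∀ᵐ t ∂μ, δ ≤ ‖z - ((t : ℝ) : ℂ)‖) (n : ℕ) :
    lommelA q ν n * lommelPhi q ν μ z n + lommelB q ν (n + 1) * lommelPhi q ν μ z (n + 1)
      + lommelA q ν (n + 1) * lommelPhi q ν μ z (n + 2) = z * lommelPhi q ν μ z (n + 1) := by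
  have hr := lommelPhi_rec hq h hδ hz (lommelP q ν (n + 1))
  rw [h.integral_lommelP, if_neg n.succ_ne_zero, X_mul_lommelP_succ hq] at hr
  simp only [Polynomial.eval_add, Polynomial.eval_smul, smul_eq_mul, Complex.ofReal_add,
    Complex.ofReal_mul, add_mul, mul_assoc] at hr
  have hI := fun n => integrable_mul_inv_sub hδ hz (h.integrable_lommelP n)
  rw [integral_linear_combination_three _ _ _ (hI _) (hI _) (hI _)] at hr
  simpa [lommelPhi] using hr

/-- Parseval for t P_{n+1}, whose coordinates in the orthonormal family are the recurrence
coefficients. -/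
theorem integral_sq_mul_lommelP_sq (hq : 0 < q) (h : IsLommelOrthogonalityMeasure q ν μ) (n : ℕ) :
    ∫ t, t ^ 2 * ((lommelP q ν (n + 1)).eval t * (lommelP q ν (n + 1)).eval t) ∂μ =
      lommelA q ν n ^ 2 + lommelB q ν (n + 1) ^ 2 + lommelA q ν (n + 1) ^ 2 := by
  set a := lommelA q ν n
  set b := lommelB q ν (n + 1)
  set c := lommelA q ν (n + 1)
  set P := fun k t => (lommelP q ν k).eval t with hPdef
  have hX : ∀ t, t * P (n + 1) t = a * P n t + b * P (n + 1) t + c * P (n + 2) t := fun t => by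
    simpa using congrArg (Polynomial.eval t) (X_mul_lommelP_succ (ν := ν) hq n)
  have hI : ∀ i j, Integrable (fun t => P i t * P j t) μ := h.integrable
  have hO : ∀ i j, ∫ t, P i t * P j t ∂μ = if i = j then 1 else 0 := h.orthonormal
  have hmul : ∀ j, ∫ t, (t * P (n + 1) t) * P j t ∂μ =
      a * (if n = j then 1 else 0) + b * (if n + 1 = j then 1 else 0)
        + c * (if n + 2 = j then 1 else 0) := fun j => by
    rw [← hO, ← hO, ← hO, ← integral_linear_combination_three _ _ _ (hI _ _) (hI _ _) (hI _ _)]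
    refine integral_congr_ae (Eventually.of_forall fun t => ?_)
    simp only [hX]
    ring
  have hmulI : ∀ j, Integrable (fun t => (t * P (n + 1) t) * P j t) μ := fun j => by
    refine (((((hI n j).const_mul a).add ((hI (n + 1) j).const_mul b))).add
      ((hI (n + 2) j).const_mul c)).congr (Eventually.of_forall fun t => ?_)
    simp only [Pi.add_apply, hX]
    ring
  have hfin : ∫ t, t ^ 2 * (P (n + 1) t * P (n + 1) t) ∂μ =
      ∫ t, (a * ((t * P (n + 1) t) * P n t) + b * ((t * P (n + 1) t) * P (n + 1) t))
        + c * ((t * P (n + 1) t) * P (n + 2) t) ∂μ := by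
    refine integral_congr_ae (Eventually.of_forall fun t => ?_)
    have : t ^ 2 * (P (n + 1) t * P (n + 1) t) = (t * P (n + 1) t) * (t * P (n + 1) t) := by ring
    simp only [this]
    nth_rewrite 2 [hX]
    ring
  refine hfin.trans ?_
  rw [integral_linear_combination_three _ _ _ (hmulI _) (hmulI _) (hmulI _), hmul, hmul, hmul]
  simp
  ring

/-- If the support stayed at distance δ from 0, the norm of t P_{n+1} would be at least δ, but it
tends to 0 with the coefficients. This rules out z = 0, where the theta products lose their meaning.
-/
theorem zero_mem_support (hq0 : 0 < q) (hq1 : q < 1) (h : IsLommelOrthogonalityMeasure q ν μ) :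
    (0 : ℂ) ∈ (fun t : ℝ => (t : ℂ)) '' μ.support := by
  by_contra hz
  obtain ⟨δ, hδ, hle⟩ := exists_pos_le_norm_sub_of_notMem_support hz
  have hbound : ∀ n, δ ^ 2 ≤
      lommelA q ν n ^ 2 + lommelB q ν (n + 1) ^ 2 + lommelA q ν (n + 1) ^ 2 := fun n => by
    rw [← h.integral_sq_mul_lommelP_sq hq0 n]
    have hI := h.integrable (n + 1) (n + 1)
    have hi2 : Integrable (fun t =>
        t ^ 2 * ((lommelP q ν (n + 1)).eval t * (lommelP q ν (n + 1)).eval t)) μ := by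
      refine (h.integrable_polynomial hq0 (Polynomial.X ^ 2 *
        (lommelP q ν (n + 1) * lommelP q ν (n + 1)))).congr (Eventually.of_forall fun t => ?_)
      simp only [Polynomial.eval_mul, Polynomial.eval_pow, Polynomial.eval_X]
    have h1 := integral_mono_ae (hI.const_mul (δ ^ 2)) hi2 (by
      filter_upwards [hle] with t ht
      rw [zero_sub, norm_neg, Complex.norm_real, Real.norm_eq_abs] at ht
      refine mul_le_mul_of_nonneg_right ?_ (mul_self_nonneg _)
      rw [← sq_abs t]
      exact pow_le_pow_left₀ hδ.le ht 2)
    rw [integral_const_mul, h.orthonormal, if_pos rfl, mul_one] at h1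
    exact h1
  have hA : Tendsto (fun n => lommelA q ν n) atTop (𝓝 0) :=
    (tendsto_zero_iff_abs_tendsto_zero _).2 (summable_lommelA hq0 hq1 ν).tendsto_atTop_zero
  have hB : Tendsto (fun n => lommelB q ν n) atTop (𝓝 0) :=
    (tendsto_zero_iff_abs_tendsto_zero _).2 (summable_lommelB hq0 hq1 ν).tendsto_atTop_zero
  have hlim := ((hA.pow 2).add (((tendsto_add_atTop_iff_nat 1).2 hB).pow 2)).add
    (((tendsto_add_atTop_iff_nat 1).2 hA).pow 2)
  have := ge_of_tendsto' hlim hbound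
  have : 0 < δ ^ 2 := by positivity
  norm_num at *
  linarith

theorem continuousAt_stieltjes [IsFiniteMeasure μ] {z : ℂ}
    (hz : z ∉ (fun t : ℝ => (t : ℂ)) '' μ.support) :
    ContinuousAt (fun w : ℂ => ∫ t : ℝ, 1 / (w - (t : ℂ)) ∂μ) z := by
  obtain ⟨δ, hδ, hle⟩ := exists_pos_le_norm_sub_of_notMem_support hz
  refine continuousAt_of_dominated (bound := fun _ => (δ / 2)⁻¹) ?_ ?_ (integrable_const _) ?_
  · exact Eventually.of_forall fun w =>
      (by fun_prop : Measurable fun t : ℝ => 1 / (w - (t : ℂ))).aestronglyMeasurable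
  · filter_upwards [Metric.ball_mem_nhds z (half_pos hδ)] with w hw
    filter_upwards [hle] with t ht
    rw [norm_div, norm_one, one_div]
    refine inv_anti₀ (half_pos hδ) ?_
    have h1 := norm_sub_le_norm_sub_add_norm_sub z w (t : ℂ)
    rw [Metric.mem_ball, dist_comm, Complex.dist_eq] at hw
    linarith
  · filter_upwards [hle] with t ht
    have hne : z - (t : ℂ) ≠ 0 := norm_pos_iff.1 (hδ.trans_le ht)
    fun_prop (disch := exact hne)

end IsLommelOrthogonalityMeasure

/-! ### q-shifted factorials and Gaussian summability -/

section QPochhammer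

variable {a p : ℂ}

theorem summable_norm_mul_pow (a : ℂ) (hp : ‖p‖ < 1) : Summable fun k : ℕ => ‖-(a * p ^ k)‖ := by
  simpa using (summable_geometric_of_lt_one (norm_nonneg p) hp).mul_left ‖a‖

theorem tendsto_qPoch (a : ℂ) (hp : ‖p‖ < 1) :
    Tendsto (qPoch a p) atTop (𝓝 (qPochInf a p)) := by
  have h : Multipliable fun k : ℕ => 1 + -(a * p ^ k) :=
    multipliable_one_add_of_summable (summable_norm_mul_pow a hp)
  have h' := h.tendsto_prod_tprod_nat
  simp only [← sub_eq_add_neg] at h'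
  exact h'

theorem qPoch_succ (a p : ℂ) (n : ℕ) : qPoch a p (n + 1) = qPoch a p n * (1 - a * p ^ n) :=
  Finset.prod_range_succ _ _

theorem qPoch_ne_zero (h : ∀ k : ℕ, 1 - a * p ^ k ≠ 0) (n : ℕ) : qPoch a p n ≠ 0 :=
  Finset.prod_ne_zero_iff.2 fun k _ => h k

theorem qPochInf_ne_zero (hp : ‖p‖ < 1) (h : ∀ k : ℕ, 1 - a * p ^ k ≠ 0) : qPochInf a p ≠ 0 := by
  have := tprod_one_add_ne_zero_of_summable (f := fun k : ℕ => -(a * p ^ k))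
    (fun k => by simpa [sub_eq_add_neg] using h k) (summable_norm_mul_pow a hp)
  simpa only [qPochInf, sub_eq_add_neg] using this

theorem exists_eq_of_qPochInf_eq_zero (hp : ‖p‖ < 1) (h : qPochInf a p = 0) :
    ∃ k : ℕ, a * p ^ k = 1 := by
  by_contra! hne
  exact qPochInf_ne_zero hp (fun k => sub_ne_zero.2 (hne k).symm) h

theorem exists_norm_inv_qPoch_le (hp : ‖p‖ < 1) (h : ∀ k : ℕ, 1 - a * p ^ k ≠ 0) :
    ∃ C, ∀ n, ‖(qPoch a p n)⁻¹‖ ≤ C := by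
  have hlim := ((tendsto_qPoch a hp).inv₀ (qPochInf_ne_zero hp h)).norm
  obtain ⟨C, hC⟩ := hlim.bddAbove_range
  exact ⟨C, fun n => hC ⟨n, rfl⟩⟩

end QPochhammer

theorem summable_pow_mul_add_one_mul_pow {q : ℝ} (hq0 : 0 < q) (hq1 : q < 1) (r : ℝ) :
    Summable fun k : ℕ => q ^ (k * (k + 1)) * r ^ k := by
  have hlim : Tendsto (fun k : ℕ => q ^ 2 * |r| * (q ^ 2) ^ k) atTop (𝓝 (q ^ 2 * |r| * 0)) :=
    (tendsto_pow_atTop_nhds_zero_of_lt_one (sq_nonneg q) (by nlinarith)).const_mul _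
  rw [mul_zero] at hlim
  refine summable_of_ratio_norm_eventually_le (r := 1 / 2) (by norm_num) ?_
  filter_upwards [hlim.eventually_le_const (show (0 : ℝ) < 1 / 2 by norm_num)] with k hk
  rw [norm_mul, norm_mul, norm_pow, norm_pow, norm_pow, norm_pow, Real.norm_eq_abs,
    Real.norm_eq_abs, abs_of_pos hq0]
  calc q ^ ((k + 1) * (k + 1 + 1)) * |r| ^ (k + 1)
      = (q ^ 2 * |r| * (q ^ 2) ^ k) * (q ^ (k * (k + 1)) * |r| ^ k) := by ring
    _ ≤ 1 / 2 * (q ^ (k * (k + 1)) * |r| ^ k) :=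
        mul_le_mul_of_nonneg_right hk (by positivity)

theorem summable_zpow_mul_add_one_mul_zpow {q : ℝ} (hq0 : 0 < q) (hq1 : q < 1) (r : ℝ) :
    Summable fun j : ℤ => q ^ (j * (j + 1)) * r ^ j := by
  refine Summable.of_nat_of_neg ?_ ?_
  · refine (summable_pow_mul_add_one_mul_pow hq0 hq1 r).congr fun k => ?_
    rw [zpow_natCast, ← zpow_natCast q]
    push_cast
    rfl
  -- With j = -k, j(j+1) = k(k+1) - 2k; the surplus q^{-2k} is absorbed into the base.
  · refine (summable_pow_mul_add_one_mul_pow hq0 hq1 (q⁻¹ ^ 2 * r⁻¹)).congr fun k => ?_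
    rw [zpow_neg, zpow_natCast, mul_pow, ← mul_assoc, inv_pow r]
    congr 1
    rw [← pow_mul, inv_pow, ← zpow_natCast q, ← zpow_natCast q, ← zpow_neg,
      ← zpow_add₀ hq0.ne']
    congr 1
    push_cast
    ring

/-- Convolving a summable family on `ℤ` with a null sequence on `ℕ`. -/
theorem tendsto_tsum_shift_mul_zero {G : ℤ → ℂ} (hG : Summable fun j => ‖G j‖) {c : ℕ → ℂ}
    (hc : Tendsto c atTop (𝓝 0)) :
    Tendsto (fun n : ℕ => ∑' k : ℕ, G ((k : ℤ) - n) * c k) atTop (𝓝 0) := by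
  -- Extending `c` by zero turns the sum into one over j = k - n in ℤ. For fixed j the factor c(j +
  -- n) tends to 0, and dominated convergence applies.
  let c' : ℤ → ℂ := fun m => if 0 ≤ m then c m.toNat else 0
  have hre : ∀ n : ℕ, ∑' k : ℕ, G ((k : ℤ) - n) * c k = ∑' j : ℤ, G j * c' (j + n) := fun n => by
    rw [← (Equiv.subRight (n : ℤ)).tsum_eq (fun j : ℤ => G j * c' (j + n))]
    rw [← (Nat.cast_injective (R := ℤ)).tsum_eq]
    · refine tsum_congr fun k => ?_
      simp [c']
    · intro m hm
      by_cases h0 : 0 ≤ m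
      · exact ⟨m.toNat, by simp [h0]⟩
      · simp [c', h0] at hm
  simp only [hre]
  obtain ⟨M, hM⟩ := hc.norm.bddAbove_range
  have hM' : ∀ k, ‖c k‖ ≤ M := fun k => hM ⟨k, rfl⟩
  have hlim : Tendsto (fun n : ℕ => ∑' j : ℤ, G j * c' (j + n)) atTop (𝓝 (∑' _ : ℤ, 0)) := by
    refine tendsto_tsum_of_dominated_convergence (bound := fun j => ‖G j‖ * M) (hG.mul_right M)
      (fun j => ?_) (Eventually.of_forall fun n j => ?_)
    · have h1 : Tendsto (fun n : ℕ => c ((j + n).toNat)) atTop (𝓝 0) := by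
        refine hc.comp (tendsto_atTop.2 fun b => ?_)
        filter_upwards [eventually_ge_atTop (b + j.natAbs)] with n hn
        omega
      have h2 : Tendsto (fun n : ℕ => c' (j + n)) atTop (𝓝 0) := by
        refine h1.congr' ?_
        filter_upwards [eventually_ge_atTop j.natAbs] with n hn
        have : 0 ≤ j + n := by omega
        simp [c', this]
      simpa using h2.const_mul (G j)
    · rw [norm_mul]
      refine mul_le_mul_of_nonneg_left ?_ (norm_nonneg _)
      by_cases h0 : 0 ≤ j + n
      · simpa [c', h0] using hM' _
      · simpa [c', h0] using (norm_nonneg _).trans (hM' 0)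
  simpa using hlim

/-! ### The q-Bessel series: q-difference equation and growth -/

/-- The entire function `∑ q^{k(k+1)} y^k / ((q²;q²)_k (b;q²)_k)`. -/
noncomputable def qBesselSeries (q : ℝ) (b y : ℂ) : ℂ :=
  ∑' k : ℕ, (q : ℂ) ^ (k * (k + 1)) /
    (qPoch ((q : ℂ) ^ 2) ((q : ℂ) ^ 2) k * qPoch b ((q : ℂ) ^ 2) k) * y ^ k

section QBesselSeries

variable {q : ℝ} {b : ℂ}

theorem norm_ofReal_sq_lt_one (hq0 : 0 < q) (hq1 : q < 1) : ‖(q : ℂ) ^ 2‖ < 1 := by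
  rw [norm_pow, Complex.norm_real, Real.norm_eq_abs, abs_of_pos hq0]
  nlinarith

theorem one_sub_sq_mul_pow_ne_zero (hq0 : 0 < q) (hq1 : q < 1) (k : ℕ) :
    1 - (q : ℂ) ^ 2 * ((q : ℂ) ^ 2) ^ k ≠ 0 := by
  have h : (q ^ 2) ^ (k + 1) < 1 := pow_lt_one₀ (sq_nonneg q) (by nlinarith) (by simp)
  rw [← pow_succ', sub_ne_zero]
  exact_mod_cast h.ne'

theorem exists_norm_qBesselSeries_term_le (hq0 : 0 < q) (hq1 : q < 1)
    (hb : ∀ k : ℕ, 1 - b * ((q : ℂ) ^ 2) ^ k ≠ 0) :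
    ∃ C, ∀ (y : ℂ) (k : ℕ), ‖(q : ℂ) ^ (k * (k + 1)) /
      (qPoch ((q : ℂ) ^ 2) ((q : ℂ) ^ 2) k * qPoch b ((q : ℂ) ^ 2) k) * y ^ k‖ ≤
        C * (q ^ (k * (k + 1)) * ‖y‖ ^ k) := by
  have hp := norm_ofReal_sq_lt_one hq0 hq1
  obtain ⟨C₁, h₁⟩ := exists_norm_inv_qPoch_le hp (one_sub_sq_mul_pow_ne_zero hq0 hq1)
  obtain ⟨C₂, h₂⟩ := exists_norm_inv_qPoch_le hp hb
  refine ⟨C₁ * C₂, fun y k => ?_⟩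
  rw [div_eq_mul_inv, mul_inv, norm_mul, norm_mul, norm_mul, norm_pow, norm_pow,
    Complex.norm_real, Real.norm_eq_abs, abs_of_pos hq0]
  have h3 := mul_le_mul (h₁ k) (h₂ k) (norm_nonneg _) ((norm_nonneg _).trans (h₁ k))
  calc _ = (‖(qPoch ((q : ℂ) ^ 2) ((q : ℂ) ^ 2) k)⁻¹‖ * ‖(qPoch b ((q : ℂ) ^ 2) k)⁻¹‖) *
        (q ^ (k * (k + 1)) * ‖y‖ ^ k) := by ring
    _ ≤ _ := mul_le_mul_of_nonneg_right h3 (by positivity)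

theorem summable_qBesselSeries (hq0 : 0 < q) (hq1 : q < 1)
    (hb : ∀ k : ℕ, 1 - b * ((q : ℂ) ^ 2) ^ k ≠ 0) (y : ℂ) :
    Summable fun k : ℕ => (q : ℂ) ^ (k * (k + 1)) /
      (qPoch ((q : ℂ) ^ 2) ((q : ℂ) ^ 2) k * qPoch b ((q : ℂ) ^ 2) k) * y ^ k := by
  obtain ⟨C, hC⟩ := exists_norm_qBesselSeries_term_le hq0 hq1 hb
  exact Summable.of_norm_bounded
    ((summable_pow_mul_add_one_mul_pow hq0 hq1 ‖y‖).mul_left C) (hC y)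

theorem differentiable_qBesselSeries (hq0 : 0 < q) (hq1 : q < 1)
    (hb : ∀ k : ℕ, 1 - b * ((q : ℂ) ^ 2) ^ k ≠ 0) : Differentiable ℂ (qBesselSeries q b) := by
  obtain ⟨C, hC⟩ := exists_norm_qBesselSeries_term_le hq0 hq1 hb
  have hC0 : 0 ≤ C := by simpa [qPoch] using (norm_nonneg _).trans (hC 1 0)
  intro y
  have hd : DifferentiableOn ℂ (qBesselSeries q b) (Metric.ball 0 (‖y‖ + 1)) := by
    refine Complex.differentiableOn_tsum_of_summable_norm
      ((summable_pow_mul_add_one_mul_pow hq0 hq1 (‖y‖ + 1)).mul_left C)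
      (fun k => by fun_prop) Metric.isOpen_ball fun k w hw => (hC w k).trans ?_
    rw [mem_ball_zero_iff] at hw
    gcongr
  exact hd.differentiableAt (Metric.isOpen_ball.mem_nhds (by simp))

@[simp]
theorem qBesselSeries_zero (q : ℝ) (b : ℂ) : qBesselSeries q b 0 = 1 := by
  rw [qBesselSeries, tsum_eq_single 0]
  · simp [qPoch]
  · intro k hk
    simp [hk]

theorem tendsto_qBesselSeries_pow_mul (hq0 : 0 < q) (hq1 : q < 1)
    (hb : ∀ k : ℕ, 1 - b * ((q : ℂ) ^ 2) ^ k ≠ 0) (y : ℂ) :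
    Tendsto (fun n : ℕ => qBesselSeries q b (((q : ℂ) ^ 2) ^ n * y)) atTop (𝓝 1) := by
  have h1 : Tendsto (fun n : ℕ => ((q : ℂ) ^ 2) ^ n * y) atTop (𝓝 (0 * y)) :=
    (tendsto_pow_atTop_nhds_zero_of_norm_lt_one (norm_ofReal_sq_lt_one hq0 hq1)).mul_const y
  rw [zero_mul] at h1
  have h2 := ((differentiable_qBesselSeries hq0 hq1 hb).continuous.tendsto 0).comp h1
  rwa [qBesselSeries_zero] at h2

/-- The second-order `q`-difference equation. -/
theorem qBesselSeries_qDifference (hq0 : 0 < q) (hq1 : q < 1) {d : ℂ}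
    (hb : ∀ k : ℕ, 1 - (q : ℂ) ^ 2 * d * ((q : ℂ) ^ 2) ^ k ≠ 0) (y : ℂ) :
    qBesselSeries q ((q : ℂ) ^ 2 * d) y + d * qBesselSeries q ((q : ℂ) ^ 2 * d)
        (((q : ℂ) ^ 2) ^ 2 * y) =
      (1 + d + (q : ℂ) ^ 2 * y) * qBesselSeries q ((q : ℂ) ^ 2 * d) ((q : ℂ) ^ 2 * y) := by
  set p : ℂ := (q : ℂ) ^ 2 with hpdef
  set f : ℕ → ℂ := fun k => (q : ℂ) ^ (k * (k + 1)) / (qPoch p p k * qPoch (p * d) p k) with hf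
  have hS : ∀ x, Summable fun k => f k * x ^ k := summable_qBesselSeries hq0 hq1 hb
  have hF : ∀ x, qBesselSeries q (p * d) x = ∑' k, f k * x ^ k := fun _ => rfl
  have hrec : ∀ k, f (k + 1) * ((1 - p ^ (k + 1)) * (1 - d * p ^ (k + 1))) = p ^ (k + 1) * f k := by
    intro k
    have h1 := one_sub_sq_mul_pow_ne_zero hq0 hq1 k
    have h2 : 1 - p * p ^ k * d ≠ 0 := by
      rw [mul_right_comm]
      exact hb k
    have h3 := qPoch_ne_zero (one_sub_sq_mul_pow_ne_zero hq0 hq1) k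
    have h4 := qPoch_ne_zero hb k
    rw [← hpdef] at h1 h3
    simp only [hf, qPoch_succ]
    have h5 : 1 - p ^ (k + 1) = 1 - p * p ^ k := by ring
    have h6 : 1 - d * p ^ (k + 1) = 1 - p * d * p ^ k := by ring
    have h7 : (q : ℂ) ^ ((k + 1) * (k + 1 + 1)) = p ^ (k + 1) * (q : ℂ) ^ (k * (k + 1)) := by
      rw [hpdef]; ring
    rw [h5, h6, h7]
    field_simp
  -- The k-th coefficient acquires the factor 1 + dp^{2k} - (1 + d)p^k = (1 - p^k)(1 - dp^k), which
  -- kills k = 0 and is cancelled by `hrec` for k ≥ 1.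
  have hcomb : ∑' k, (f k * y ^ k + d * (f k * (p ^ 2 * y) ^ k) - (1 + d) * (f k * (p * y) ^ k)) =
      p * y * ∑' k, f k * (p * y) ^ k := by
    have hs : Summable fun k => f k * y ^ k + d * (f k * (p ^ 2 * y) ^ k)
        - (1 + d) * (f k * (p * y) ^ k) :=
      ((hS y).add ((hS _).mul_left d)).sub ((hS _).mul_left (1 + d))
    rw [hs.tsum_eq_zero_add, ← tsum_mul_left]
    have h0 : f 0 * y ^ 0 + d * (f 0 * (p ^ 2 * y) ^ 0) - (1 + d) * (f 0 * (p * y) ^ 0) = 0 := by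
      ring
    rw [h0, zero_add]
    refine tsum_congr fun k => ?_
    linear_combination y ^ (k + 1) * hrec k
  rw [Summable.tsum_sub ((hS y).add ((hS _).mul_left d)) ((hS _).mul_left (1 + d)),
    Summable.tsum_add (hS y) ((hS _).mul_left d), tsum_mul_left, tsum_mul_left] at hcomb
  rw [hF, hF, hF]
  linear_combination hcomb

theorem qBesselSeries_zero_param_step (hq0 : 0 < q) (hq1 : q < 1) (y : ℂ) :
    qBesselSeries q 0 y = (1 + (q : ℂ) ^ 2 * y) * qBesselSeries q 0 ((q : ℂ) ^ 2 * y) := by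
  have h := qBesselSeries_qDifference hq0 hq1 (d := 0) (by simp) y
  simpa using h

/-- Euler's identity. -/
theorem qBesselSeries_zero_param (hq0 : 0 < q) (hq1 : q < 1) (y : ℂ) :
    qBesselSeries q 0 y = qPochInf (-((q : ℂ) ^ 2 * y)) ((q : ℂ) ^ 2) := by
  have hfin : ∀ n, qBesselSeries q 0 y =
      qPoch (-((q : ℂ) ^ 2 * y)) ((q : ℂ) ^ 2) n * qBesselSeries q 0 (((q : ℂ) ^ 2) ^ n * y) := by
    intro n
    induction n with
    | zero => simp [qPoch]
    | succ n ih =>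
      rw [ih, qBesselSeries_zero_param_step hq0 hq1 (((q : ℂ) ^ 2) ^ n * y), qPoch_succ]
      ring_nf
  have hlim := (tendsto_qPoch (-((q : ℂ) ^ 2 * y)) (norm_ofReal_sq_lt_one hq0 hq1)).mul
    (tendsto_qBesselSeries_pow_mul hq0 hq1 (b := 0) (by simp) y)
  simp only [← hfin, mul_one] at hlim
  exact tendsto_nhds_unique tendsto_const_nhds hlim

/-- By Euler's product, moving from z to p^{-n}z adds the factors 1 + p^{-i}z, i < n. Extracting
p^{-i}z from each leaves (-1/z; p)_n, and the prefactor cancels the extracted monomials. -/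
theorem tendsto_qBesselSeries_zero_param (hq0 : 0 < q) (hq1 : q < 1) {z : ℂ} (hz : z ≠ 0) :
    Tendsto (fun n : ℕ => ((q : ℂ) * z)⁻¹ ^ n * (q : ℂ) ^ (n * n) *
      qBesselSeries q 0 ((((q : ℂ) ^ 2)⁻¹) ^ n * z)) atTop (𝓝 (lommelTheta q z)) := by
  have hqc : (q : ℂ) ≠ 0 := by exact_mod_cast hq0.ne'
  have hfin : ∀ n : ℕ, ((q : ℂ) * z)⁻¹ ^ n * (q : ℂ) ^ (n * n) *
      qBesselSeries q 0 ((((q : ℂ) ^ 2)⁻¹) ^ n * z) =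
        qPoch (-z⁻¹) ((q : ℂ) ^ 2) n * qPochInf (-((q : ℂ) ^ 2 * z)) ((q : ℂ) ^ 2) := by
    intro n
    induction n with
    | zero => simp [qPoch, qBesselSeries_zero_param hq0 hq1]
    | succ n ih =>
      have h1 : (q : ℂ) ^ 2 * ((((q : ℂ) ^ 2)⁻¹) ^ (n + 1) * z) = (((q : ℂ) ^ 2)⁻¹) ^ n * z := by
        rw [pow_succ' _ n, mul_assoc, mul_inv_cancel_left₀ (pow_ne_zero 2 hqc)]
      have h2 : (q : ℂ) ^ ((n + 1) * (n + 1)) = (q : ℂ) ^ (n * n) * ((q : ℂ) ^ 2) ^ n * q := by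
        ring
      have h3 : ((q : ℂ) ^ 2) ^ n * ((((q : ℂ) ^ 2)⁻¹) ^ n) = 1 := by
        rw [← mul_pow, mul_inv_cancel₀ (by positivity), one_pow]
      rw [qBesselSeries_zero_param_step hq0 hq1, h1, h2, qPoch_succ, pow_succ (((q : ℂ) * z)⁻¹)]
      have h4 : ((q : ℂ) * z)⁻¹ * q = z⁻¹ := by field_simp
      have h5 : z⁻¹ * z = 1 := inv_mul_cancel₀ hz
      linear_combination (1 + z⁻¹ * ((q : ℂ) ^ 2) ^ n) * ih +
        ((q : ℂ) * z)⁻¹ ^ n * (q : ℂ) ^ (n * n) * qBesselSeries q 0 ((((q : ℂ) ^ 2)⁻¹) ^ n * z) *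
        (((q : ℂ) ^ 2) ^ n * (1 + (((q : ℂ) ^ 2)⁻¹) ^ n * z) * h4 + z⁻¹ * z * h3 + h5)
  simp only [hfin]
  exact (tendsto_qPoch _ (norm_ofReal_sq_lt_one hq0 hq1)).mul_const _

/-- Comparison with b = 0. The coefficients of B·F_b and F_0 differ by q^{k(k+1)} times a null
sequence, since (b;p)_k tends to B. After rescaling, the monomials form a shifted summable bilateral
series, so the difference vanishes in the limit. -/
theorem tendsto_qBesselSeries_theta (hq0 : 0 < q) (hq1 : q < 1)
    (hb : ∀ k : ℕ, 1 - b * ((q : ℂ) ^ 2) ^ k ≠ 0) {z : ℂ} (hz : z ≠ 0) :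
    Tendsto (fun n : ℕ => ((q : ℂ) * z)⁻¹ ^ n * (q : ℂ) ^ (n * n) *
      qBesselSeries q b ((((q : ℂ) ^ 2)⁻¹) ^ n * z)) atTop
      (𝓝 (lommelTheta q z / qPochInf b ((q : ℂ) ^ 2))) := by
  have hqc : (q : ℂ) ≠ 0 := by exact_mod_cast hq0.ne'
  have hp := norm_ofReal_sq_lt_one hq0 hq1
  have hbinf := qPochInf_ne_zero hp hb
  have hpp := one_sub_sq_mul_pow_ne_zero hq0 hq1
  set B := qPochInf b ((q : ℂ) ^ 2) with hB
  let c : ℕ → ℂ := fun k => (qPoch ((q : ℂ) ^ 2) ((q : ℂ) ^ 2) k)⁻¹ *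
    (B * (qPoch b ((q : ℂ) ^ 2) k)⁻¹ - 1)
  have hc : Tendsto c atTop (𝓝 0) := by
    have h1 := ((tendsto_qPoch ((q : ℂ) ^ 2) hp).inv₀ (qPochInf_ne_zero hp hpp)).mul
      ((((tendsto_qPoch b hp).inv₀ hbinf).const_mul B).sub_const 1)
    rwa [mul_inv_cancel₀ hbinf, sub_self, mul_zero] at h1
  have hG : Summable fun j : ℤ => ‖(q : ℂ) ^ (j * (j + 1)) * z ^ j‖ := by
    refine (summable_zpow_mul_add_one_mul_zpow hq0 hq1 ‖z‖).congr fun j => ?_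
    rw [norm_mul, norm_zpow, norm_zpow, Complex.norm_real, Real.norm_eq_abs, abs_of_pos hq0]
  have hdiff := tendsto_tsum_shift_mul_zero hG hc
  have hexp : ∀ n k : ℕ, (q : ℂ) ^ (((k : ℤ) - n) * ((k : ℤ) - n + 1)) * z ^ ((k : ℤ) - n) =
      ((q : ℂ) * z)⁻¹ ^ n * (q : ℂ) ^ (n * n) * ((q : ℂ) ^ (k * (k + 1)) *
        ((((q : ℂ) ^ 2)⁻¹) ^ n * z) ^ k) := by
    intro n k
    have h1 : ((k : ℤ) - n) * ((k : ℤ) - n + 1) =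
        -(n : ℤ) + ((n * n : ℕ) : ℤ) + ((k * (k + 1) : ℕ) : ℤ) + -((2 * n * k : ℕ) : ℤ) := by
      push_cast; ring
    rw [h1, zpow_add₀ hqc, zpow_add₀ hqc, zpow_add₀ hqc, zpow_sub₀ hz, zpow_neg, zpow_neg,
      zpow_natCast, zpow_natCast, zpow_natCast, zpow_natCast, zpow_natCast, zpow_natCast]
    rw [mul_pow _ z, ← pow_mul, inv_pow ((q : ℂ) ^ 2), ← pow_mul, inv_pow, mul_pow]
    rw [mul_inv, mul_assoc 2 n k]
    ring
  have hid : ∀ n : ℕ, ∑' k : ℕ, ((q : ℂ) ^ (((k : ℤ) - n) * ((k : ℤ) - n + 1)) * z ^ ((k : ℤ) - n)) *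
      c k = B * (((q : ℂ) * z)⁻¹ ^ n * (q : ℂ) ^ (n * n) *
        qBesselSeries q b ((((q : ℂ) ^ 2)⁻¹) ^ n * z)) - ((q : ℂ) * z)⁻¹ ^ n * (q : ℂ) ^ (n * n) *
        qBesselSeries q 0 ((((q : ℂ) ^ 2)⁻¹) ^ n * z) := by
    intro n
    have hSb := summable_qBesselSeries hq0 hq1 hb ((((q : ℂ) ^ 2)⁻¹) ^ n * z)
    have hS0 := summable_qBesselSeries hq0 hq1 (b := 0) (by simp) ((((q : ℂ) ^ 2)⁻¹) ^ n * z)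
    rw [qBesselSeries, qBesselSeries, ← tsum_mul_left, ← tsum_mul_left, ← tsum_mul_left,
      ← Summable.tsum_sub ((hSb.mul_left _).mul_left _) (hS0.mul_left _)]
    refine tsum_congr fun k => ?_
    have h0 : qPoch 0 ((q : ℂ) ^ 2) k = 1 := by simp [qPoch]
    rw [hexp, h0]
    simp only [c, div_eq_mul_inv, mul_inv, mul_one]
    ring
  simp only [hid] at hdiff
  have hsum := (hdiff.add (tendsto_qBesselSeries_zero_param hq0 hq1 hz)).const_mul B⁻¹
  rw [zero_add, ← div_eq_inv_mul] at hsum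
  refine hsum.congr fun n => ?_
  rw [sub_add_cancel, inv_mul_cancel_left₀ hbinf]

end QBesselSeries

/-! ### Wronskian and the bounded solution of the recurrence -/

section MinimalSolution

variable {q : ℝ} {d : ℂ}

/-- The two q-difference equations make the expression invariant under z ↦ pz. Iterating sends the
arguments to 0, where both series equal 1. -/
theorem qBesselSeries_wronskian (hq0 : 0 < q) (hq1 : q < 1) (hd : d ≠ 0)
    (hb : ∀ k : ℕ, 1 - (q : ℂ) ^ 2 * d * ((q : ℂ) ^ 2) ^ k ≠ 0)
    (hb' : ∀ k : ℕ, 1 - (q : ℂ) ^ 2 * d⁻¹ * ((q : ℂ) ^ 2) ^ k ≠ 0) (z : ℂ) :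
    d⁻¹ * qBesselSeries q ((q : ℂ) ^ 2 * d) z *
        qBesselSeries q ((q : ℂ) ^ 2 * d⁻¹) ((q : ℂ) ^ 2 * (d⁻¹ * z)) -
      qBesselSeries q ((q : ℂ) ^ 2 * d) ((q : ℂ) ^ 2 * z) *
        qBesselSeries q ((q : ℂ) ^ 2 * d⁻¹) (d⁻¹ * z) = d⁻¹ - 1 := by
  set p : ℂ := (q : ℂ) ^ 2 with hp
  set F := qBesselSeries q (p * d)
  set F' := qBesselSeries q (p * d⁻¹)
  have hdd : d⁻¹ * d = 1 := inv_mul_cancel₀ hd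
  have hstep : ∀ y, d⁻¹ * F y * F' (p * (d⁻¹ * y)) - F (p * y) * F' (d⁻¹ * y) =
      d⁻¹ * F (p * y) * F' (p * (d⁻¹ * (p * y))) - F (p * (p * y)) * F' (d⁻¹ * (p * y)) := by
    intro y
    have h1 := qBesselSeries_qDifference hq0 hq1 hb y
    have h2 := qBesselSeries_qDifference hq0 hq1 hb' (d⁻¹ * y)
    rw [show ((q : ℂ) ^ 2) ^ 2 * y = p * (p * y) by rw [hp]; ring] at h1
    rw [show ((q : ℂ) ^ 2) ^ 2 * (d⁻¹ * y) = p * (d⁻¹ * (p * y)) by rw [hp]; ring] at h2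
    rw [show d⁻¹ * (p * y) = p * (d⁻¹ * y) by ring] at h2 ⊢
    linear_combination d⁻¹ * F' (p * (d⁻¹ * y)) * h1 - F (p * y) * h2 +
      F' (p * (d⁻¹ * y)) * (F (p * y) - F (p * (p * y))) * hdd
  have hiter : ∀ n : ℕ, d⁻¹ * F z * F' (p * (d⁻¹ * z)) - F (p * z) * F' (d⁻¹ * z) =
      d⁻¹ * F (p ^ n * z) * F' (p ^ n * (p * (d⁻¹ * z))) -
        F (p ^ n * (p * z)) * F' (p ^ n * (d⁻¹ * z)) := by
    intro n
    induction n with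
    | zero => simp
    | succ n ih =>
      have := hstep (p ^ n * z)
      ring_nf at this ih ⊢
      rw [ih, this]
  have hT := tendsto_qBesselSeries_pow_mul hq0 hq1 hb
  have hT' := tendsto_qBesselSeries_pow_mul hq0 hq1 hb'
  have hlim := (((hT z).const_mul d⁻¹).mul (hT' (p * (d⁻¹ * z)))).sub
    ((hT (p * z)).mul (hT' (d⁻¹ * z)))
  have hconst := hlim.congr fun n => (hiter n).symm
  simpa using tendsto_nhds_unique tendsto_const_nhds hconst

theorem tendsto_pow_mul_pow_mul_self (hq0 : 0 < q) (hq1 : q < 1) (r : ℂ) :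
    Tendsto (fun n : ℕ => r ^ n * (q : ℂ) ^ (n * n)) atTop (𝓝 0) := by
  rw [tendsto_zero_iff_norm_tendsto_zero]
  refine (summable_pow_mul_add_one_mul_pow hq0 hq1 (q⁻¹ * ‖r‖)).tendsto_atTop_zero.congr
    fun n => ?_
  rw [norm_mul, norm_pow, norm_pow, Complex.norm_real, Real.norm_eq_abs, abs_of_pos hq0]
  have h : q ^ n * q⁻¹ ^ n = 1 := by rw [← mul_pow, mul_inv_cancel₀ hq0.ne', one_pow]
  rw [mul_pow, mul_add, pow_add, mul_one]
  linear_combination q ^ (n * n) * ‖r‖ ^ n * h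

/-- Two solutions of a three-term recurrence with nonzero Wronskian span the solution space. -/
theorem exists_linear_combination_of_recurrence {K : Type*} [Field K] {A B C : ℕ → K}
    (hA : ∀ n, A n ≠ 0) {Φ U W : ℕ → K}
    (hΦ : ∀ n, A n * Φ (n + 2) + C n * Φ n = B n * Φ (n + 1))
    (hU : ∀ n, A n * U (n + 2) + C n * U n = B n * U (n + 1))
    (hW : ∀ n, A n * W (n + 2) + C n * W n = B n * W (n + 1))
    (hwr : U 1 * W 0 - U 0 * W 1 ≠ 0) :
    ∃ α β : K, ∀ n, Φ n = α * U n + β * W n := by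
  refine ⟨(Φ 1 * W 0 - Φ 0 * W 1) / (U 1 * W 0 - U 0 * W 1),
    (U 1 * Φ 0 - U 0 * Φ 1) / (U 1 * W 0 - U 0 * W 1), fun n => ?_⟩
  set α := (Φ 1 * W 0 - Φ 0 * W 1) / (U 1 * W 0 - U 0 * W 1) with hα
  set β := (U 1 * Φ 0 - U 0 * Φ 1) / (U 1 * W 0 - U 0 * W 1) with hβ
  suffices h : Φ n = α * U n + β * W n ∧ Φ (n + 1) = α * U (n + 1) + β * W (n + 1) from h.1
  induction n with
  | zero =>
    constructor
    · rw [hα, hβ, div_mul_eq_mul_div, div_mul_eq_mul_div, ← add_div, eq_div_iff hwr]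
      ring
    · rw [hα, hβ, div_mul_eq_mul_div, div_mul_eq_mul_div, ← add_div, eq_div_iff hwr]
      ring
  | succ n ih =>
    refine ⟨ih.2, mul_left_cancel₀ (hA n) ?_⟩
    linear_combination hΦ n - α * hU n - β * hW n + B n * ih.2 - C n * ih.1

/-- A bounded solution of the `q⁻¹`-Lommel recurrence, in terms of `q`-Bessel functions. -/
theorem bounded_lommel_solution (hq0 : 0 < q) (hq1 : q < 1) {c : ℂ} (hc : c ≠ 0)
    (hd1 : c ^ 2 ≠ 1)
    (hb : ∀ k : ℕ, 1 - (q : ℂ) ^ 2 * c ^ 2 * ((q : ℂ) ^ 2) ^ k ≠ 0)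
    (hb' : ∀ k : ℕ, 1 - (q : ℂ) ^ 2 * (c ^ 2)⁻¹ * ((q : ℂ) ^ 2) ^ k ≠ 0) {z : ℂ} (hz : z ≠ 0)
    (hθ : lommelTheta q z ≠ 0 ∨ lommelTheta q ((c ^ 2)⁻¹ * z) ≠ 0)
    {Φ : ℕ → ℂ} (hΦ0 : Φ 0 = q / c)
    (hΦ : ∀ n, ((q : ℂ) ^ (2 * n) * (q * c)) * Φ (n + 2) + ((q : ℂ) ^ (2 * n) * (c / q)) * Φ n =
      (z + (q : ℂ) ^ (2 * n) * (1 + c ^ 2)) * Φ (n + 1))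
    {M : ℝ} (hM : ∀ n, ‖Φ (n + 1)‖ ≤ M) {D σ : ℂ}
    (hσ : σ = qPochInf ((q : ℂ) ^ 2 * c ^ 2) ((q : ℂ) ^ 2) /
      qPochInf ((q : ℂ) ^ 2 * (c ^ 2)⁻¹) ((q : ℂ) ^ 2))
    (hD : D = (c ^ 2)⁻¹ * qBesselSeries q ((q : ℂ) ^ 2 * (c ^ 2)⁻¹)
        ((q : ℂ) ^ 2 * ((c ^ 2)⁻¹ * z)) * lommelTheta q z -
      σ * qBesselSeries q ((q : ℂ) ^ 2 * c ^ 2) ((q : ℂ) ^ 2 * z) *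
        lommelTheta q ((c ^ 2)⁻¹ * z)) :
    D ≠ 0 ∧ Φ 1 * (c ^ 2 * qBesselSeries q ((q : ℂ) ^ 2 * c ^ 2) ((q : ℂ) ^ 2 * z)) * D =
      qBesselSeries q ((q : ℂ) ^ 2 * c ^ 2) z * D - ((c ^ 2)⁻¹ - 1) * lommelTheta q z := by
  have hqc : (q : ℂ) ≠ 0 := by exact_mod_cast hq0.ne'
  have hp := norm_ofReal_sq_lt_one hq0 hq1
  have hB := qPochInf_ne_zero hp hb
  have hB' := qPochInf_ne_zero hp hb'
  have hd : c ^ 2 ≠ 0 := pow_ne_zero 2 hc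
  have hwr := qBesselSeries_wronskian hq0 hq1 hd hb hb' z
  have hlimF := tendsto_qBesselSeries_theta hq0 hq1 hb hz
  have hlimF' := tendsto_qBesselSeries_theta hq0 hq1 hb' (mul_ne_zero (inv_ne_zero hd) hz)
  have hdiff := qBesselSeries_qDifference hq0 hq1 hb
  have hdiff' := qBesselSeries_qDifference hq0 hq1 hb'
  set p : ℂ := (q : ℂ) ^ 2 with hpdef
  have hp0 : p ≠ 0 := pow_ne_zero 2 hqc
  set F := qBesselSeries q (p * c ^ 2)
  set F' := qBesselSeries q (p * (c ^ 2)⁻¹)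
  set θ := lommelTheta q z
  set θ' := lommelTheta q ((c ^ 2)⁻¹ * z)
  set B := qPochInf (p * c ^ 2) p
  set B' := qPochInf (p * (c ^ 2)⁻¹) p
  have hσ0 : σ ≠ 0 := hσ ▸ div_ne_zero hB hB'
  have hpinv : ∀ n : ℕ, (q : ℂ) ^ (2 * n) * p⁻¹ ^ n = 1 := fun n => by
    rw [pow_mul, ← hpdef, ← mul_pow, mul_inv_cancel₀ hp0, one_pow]
  let U : ℕ → ℂ := fun n => (q * c)⁻¹ ^ n * F (p⁻¹ ^ n * (p * z))
  let W : ℕ → ℂ := fun n => (c / q) ^ n * F' (p⁻¹ ^ n * (p * ((c ^ 2)⁻¹ * z)))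
  have hshift1 : ∀ (n : ℕ) (y : ℂ), p⁻¹ ^ (n + 1) * (p * y) = p⁻¹ ^ n * y := fun n y => by
    rw [pow_succ, mul_assoc, inv_mul_cancel_left₀ hp0]
  have hshift : ∀ (n : ℕ) (y : ℂ), p * (p⁻¹ ^ (n + 2) * (p * y)) = p⁻¹ ^ (n + 1) * (p * y) ∧
      p ^ 2 * (p⁻¹ ^ (n + 2) * (p * y)) = p⁻¹ ^ n * (p * y) := fun n y => by
    have h : p * p⁻¹ = 1 := mul_inv_cancel₀ hp0
    constructor
    · linear_combination p⁻¹ ^ (n + 1) * p * y * h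
    · linear_combination p⁻¹ ^ n * p * y * (p * p⁻¹ + 1) * h
  have hU : ∀ n, ((q : ℂ) ^ (2 * n) * (q * c)) * U (n + 2) + ((q : ℂ) ^ (2 * n) * (c / q)) * U n =
      (z + (q : ℂ) ^ (2 * n) * (1 + c ^ 2)) * U (n + 1) := by
    intro n
    have h := hdiff (p⁻¹ ^ (n + 2) * (p * z))
    rw [(hshift n z).1, (hshift n z).2] at h
    have e1 : (q * c) * (q * c)⁻¹ ^ (n + 2) = (q * c)⁻¹ ^ (n + 1) := by
      rw [pow_succ' _ (n + 1), mul_inv_cancel_left₀ (mul_ne_zero hqc hc)]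
    have e2 : (c / q) * (q * c)⁻¹ ^ n = c ^ 2 * (q * c)⁻¹ ^ (n + 1) := by
      rw [pow_succ' _ n, ← mul_assoc]; congr 1; field_simp
    simp only [U]
    rw [hshift1 n] at h ⊢
    linear_combination (q : ℂ) ^ (2 * n) * F (p⁻¹ ^ (n + 2) * (p * z)) * e1 +
      (q : ℂ) ^ (2 * n) * F (p⁻¹ ^ n * (p * z)) * e2 +
      (q : ℂ) ^ (2 * n) * (q * c)⁻¹ ^ (n + 1) * h +
      (q * c)⁻¹ ^ (n + 1) * F (p⁻¹ ^ n * z) * z * hpinv n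
  have hW : ∀ n, ((q : ℂ) ^ (2 * n) * (q * c)) * W (n + 2) + ((q : ℂ) ^ (2 * n) * (c / q)) * W n =
      (z + (q : ℂ) ^ (2 * n) * (1 + c ^ 2)) * W (n + 1) := by
    intro n
    have h := hdiff' (p⁻¹ ^ (n + 2) * (p * ((c ^ 2)⁻¹ * z)))
    rw [(hshift n _).1, (hshift n _).2] at h
    have e1 : (q * c) * (c / q) ^ (n + 2) = c ^ 2 * (c / q) ^ (n + 1) := by
      rw [pow_succ _ (n + 1)]; field_simp
    have e2 : (c / q) * (c / q) ^ n = (c / q) ^ (n + 1) := (pow_succ' _ _).symm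
    have e3 : c ^ 2 * (c ^ 2)⁻¹ = 1 := mul_inv_cancel₀ hd
    simp only [W]
    rw [hshift1 n] at h ⊢
    linear_combination (q : ℂ) ^ (2 * n) * F' (p⁻¹ ^ (n + 2) * (p * ((c ^ 2)⁻¹ * z))) * e1 +
      (q : ℂ) ^ (2 * n) * F' (p⁻¹ ^ n * (p * ((c ^ 2)⁻¹ * z))) * e2 +
      (q : ℂ) ^ (2 * n) * (c / q) ^ (n + 1) * c ^ 2 * h +
      (c / q) ^ (n + 1) * F' (p⁻¹ ^ n * ((c ^ 2)⁻¹ * z)) * z * hpinv n +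
      (q : ℂ) ^ (2 * n) * (c / q) ^ (n + 1) * (F' (p⁻¹ ^ n * ((c ^ 2)⁻¹ * z)) *
        (1 + p⁻¹ ^ n * z) - F' (p⁻¹ ^ n * (p * ((c ^ 2)⁻¹ * z)))) * e3
  have hU0 : U 0 = F (p * z) := by simp [U]
  have hW0 : W 0 = F' (p * ((c ^ 2)⁻¹ * z)) := by simp [W]
  have hU1 : U 1 = (q * c)⁻¹ * F z := by simp only [U]; rw [hshift1]; simp
  have hW1 : W 1 = c / q * F' ((c ^ 2)⁻¹ * z) := by simp only [W]; rw [hshift1]; simp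
  have hΔ : U 1 * W 0 - U 0 * W 1 = c / q * ((c ^ 2)⁻¹ - 1) := by
    rw [hU0, hU1, hW0, hW1, ← hwr]
    field_simp
  have hΔ0 : U 1 * W 0 - U 0 * W 1 ≠ 0 := by
    rw [hΔ]
    refine mul_ne_zero (div_ne_zero hc hqc) (sub_ne_zero.2 ?_)
    simpa using hd1
  obtain ⟨α, β, hαβ⟩ := exists_linear_combination_of_recurrence
    (fun n => mul_ne_zero (pow_ne_zero _ hqc) (mul_ne_zero hqc hc)) hΦ hU hW hΔ0
  -- The factor (c/z)^n q^{n²} sends the bounded `Φ` to 0, while `U` and `W` at n + 1 tend to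
  -- θ/(qcB) and cθ'/(qB').
  have hE : α * θ + β * (c ^ 2 * σ * θ') = 0 := by
    have hε := tendsto_pow_mul_pow_mul_self hq0 hq1 (c * z⁻¹)
    have hl1 : Tendsto (fun n : ℕ => (c * z⁻¹) ^ n * (q : ℂ) ^ (n * n) * Φ (n + 1)) atTop
        (𝓝 0) := by
      refine squeeze_zero_norm (a := fun n : ℕ => ‖(c * z⁻¹) ^ n * (q : ℂ) ^ (n * n)‖ * M)
        (fun n => ?_) (by simpa using hε.norm.mul_const M)
      rw [norm_mul]
      exact mul_le_mul_of_nonneg_left (hM n) (norm_nonneg _)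
    have hl2 := ((hlimF.const_mul (α * (q * c)⁻¹)).add (hlimF'.const_mul (β * (c / q))))
    have hl3 := tendsto_nhds_unique hl1 (hl2.congr fun n => ?_)
    · rw [hσ]
      have h4 := congrArg (fun x => x * (q * c * B)) hl3
      simp only [zero_mul] at h4
      rw [h4]
      field_simp
    · rw [hαβ]
      simp only [U, W]
      rw [hshift1, hshift1]
      have e1 : (c * z⁻¹) ^ n * (q * c)⁻¹ ^ (n + 1) = (q * c)⁻¹ * ((q : ℂ) * z)⁻¹ ^ n := by
        rw [pow_succ, ← mul_assoc, ← mul_pow, mul_comm]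
        congr 2
        field_simp
      have e2 : (c * z⁻¹) ^ n * (c / q) ^ (n + 1) =
          c / q * ((q : ℂ) * ((c ^ 2)⁻¹ * z))⁻¹ ^ n := by
        rw [pow_succ, ← mul_assoc, ← mul_pow, mul_comm]
        congr 2
        field_simp
      linear_combination -(α * (q : ℂ) ^ (n * n) * F (p⁻¹ ^ n * z)) * e1 -
        β * (q : ℂ) ^ (n * n) * F' (p⁻¹ ^ n * ((c ^ 2)⁻¹ * z)) * e2
  rw [← hU0, ← hW0] at hD
  have h0 := hαβ 0
  have h1 := hαβ 1
  have hdd : c ^ 2 * (c ^ 2)⁻¹ = 1 := mul_inv_cancel₀ hd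
  -- Cramer's rule in both unknowns. Keeping θ and θ' as multipliers avoids dividing by either, as
  -- only one of them is known to be nonzero.
  have hΦ0θ : Φ 0 * θ = β * (c ^ 2 * D) := by
    rw [hD]
    linear_combination θ * h0 + U 0 * hE - β * W 0 * θ * hdd
  have hΦ0θ' : Φ 0 * (c ^ 2 * σ * θ') = -α * (c ^ 2 * D) := by
    rw [hD]
    linear_combination c ^ 2 * σ * θ' * h0 + W 0 * hE + α * W 0 * θ * hdd
  have hΦ0ne : Φ 0 ≠ 0 := hΦ0 ▸ div_ne_zero hqc hc
  have hD0 : D ≠ 0 := by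
    rintro hD0
    rw [hD0] at hΦ0θ hΦ0θ'
    rcases hθ with h | h
    · exact mul_ne_zero hΦ0ne h (by simpa using hΦ0θ)
    · exact mul_ne_zero hΦ0ne (mul_ne_zero (mul_ne_zero hd hσ0) h) (by simpa using hΦ0θ')
  refine ⟨hD0, ?_⟩
  have hN : Φ 1 * (c ^ 2 * D) = Φ 0 * (θ * W 1 - c ^ 2 * σ * θ' * U 1) := by
    have hΦ1θ : Φ 1 * θ = β * (θ * W 1 - c ^ 2 * σ * θ' * U 1) := by
      linear_combination θ * h1 + U 1 * hE
    have hΦ1θ' : Φ 1 * (c ^ 2 * σ * θ') = -α * (θ * W 1 - c ^ 2 * σ * θ' * U 1) := by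
      linear_combination c ^ 2 * σ * θ' * h1 + W 1 * hE
    rcases hθ with h | h
    · refine mul_right_cancel₀ h ?_
      linear_combination c ^ 2 * D * hΦ1θ - (θ * W 1 - c ^ 2 * σ * θ' * U 1) * hΦ0θ
    · refine mul_right_cancel₀ (mul_ne_zero (mul_ne_zero hd hσ0) h) ?_
      linear_combination c ^ 2 * D * hΦ1θ' - (θ * W 1 - c ^ 2 * σ * θ' * U 1) * hΦ0θ'
  have hfz : (q / c) * (c ^ 2 * U 1) = F z := by
    rw [hU1]; field_simp
  have hΔ' : (q / c) * (U 1 * W 0 - U 0 * W 1) = (c ^ 2)⁻¹ - 1 := by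
    rw [hΔ]; field_simp
  rw [← hU0, ← hfz, ← hΔ']
  rw [hΦ0] at hN
  -- Since c²D = θW_0 - c²σθ'U_0, the product U_0(θW_1 - c²σθ'U_1) equals c²D·U_1 - θ(U_1W_0 -
  -- U_0W_1), and the Wronskian appears.
  linear_combination U 0 * hN - (q / c) * U 1 * c ^ 2 * hD - (q / c) * U 1 * W 0 * θ * hdd

end MinimalSolution

/-! ### Translation to the q-Bessel functions I_{±ν} -/

section Identification

variable {q ν : ℝ}

theorem rpow_two_mul_exponent (hq0 : 0 < q) (ν : ℝ) : q ^ (2 * ν) = (q ^ ν) ^ 2 := by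
  rw [← Real.rpow_natCast (q ^ ν), ← Real.rpow_mul hq0.le]
  push_cast
  ring_nf

theorem qBesselI_eq_qBesselSeries (hq0 : 0 < q) (ν : ℝ) (x : ℂ) :
    qBesselI ν (q ^ 2) x =
      qBesselSeries q ((q : ℂ) ^ 2 * (((q ^ ν : ℝ) : ℂ)) ^ 2) (x ^ 2) := by
  have h1 : (((q ^ 2) ^ (ν + 1) : ℝ) : ℂ) = (q : ℂ) ^ 2 * (((q ^ ν : ℝ) : ℂ)) ^ 2 := by
    have : (q ^ 2) ^ (ν + 1) = q ^ 2 * (q ^ ν) ^ 2 := by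
      rw [Real.rpow_add_one (by positivity), mul_comm, ← Real.rpow_two q, ← Real.rpow_mul hq0.le,
        rpow_two_mul_exponent hq0]
    rw [this]
    push_cast
    rfl
  rw [qBesselI, qBesselJ, qBesselSeries]
  refine tsum_congr fun n => ?_
  have h2 : (((q ^ 2 : ℝ) : ℂ)) ^ (n * (n + 1) / 2) = (q : ℂ) ^ (n * (n + 1)) := by
    rw [Complex.ofReal_pow, ← pow_mul, Nat.mul_div_cancel' (Nat.even_mul_succ_self n).two_dvd]
  have h3 : (-1 : ℂ) ^ n * (-1) ^ n = 1 := by rw [← mul_pow]; norm_num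
  rw [h1, h2, mul_pow, pow_mul, pow_mul, Complex.I_sq, Complex.ofReal_pow]
  linear_combination (q : ℂ) ^ (n * (n + 1)) /
    (qPoch ((q : ℂ) ^ 2) ((q : ℂ) ^ 2) n *
      qPoch ((q : ℂ) ^ 2 * (((q ^ ν : ℝ) : ℂ)) ^ 2) ((q : ℂ) ^ 2) n) * (x ^ 2) ^ n * h3

/-- `q^{2ν}` is not an integral power of `q²`. -/
theorem rpow_sq_ne_zpow (hq0 : 0 < q) (hq1 : q < 1) (hν : -1 < ν) (hνN : ∀ n : ℕ, ν ≠ (n : ℝ))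
    (m : ℤ) : ((q ^ ν : ℝ) : ℂ) ^ 2 ≠ ((q : ℂ) ^ 2) ^ m := by
  intro h
  have h1 : (q ^ ν) ^ 2 = (q ^ 2) ^ m := by exact_mod_cast h
  rw [← rpow_two_mul_exponent hq0, ← Real.rpow_intCast, ← Real.rpow_two, ← Real.rpow_mul hq0.le]
    at h1
  have h2 : 2 * ν = 2 * (m : ℝ) := (Real.strictAnti_rpow_of_base_lt_one hq0 hq1).injective h1
  have h3 : ν = m := by linarith
  rw [h3] at hν hνN
  have h4 : (-1 : ℤ) < m := by exact_mod_cast hν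
  refine hνN m.toNat ?_
  have : ((m.toNat : ℤ) : ℝ) = (m : ℝ) := by rw [Int.toNat_of_nonneg (by omega)]
  exact_mod_cast this.symm

theorem exists_zpow_of_lommelTheta_eq_zero (hq0 : 0 < q) (hq1 : q < 1) {z : ℂ} (hz : z ≠ 0)
    (h : lommelTheta q z = 0) : ∃ m : ℤ, z = -((q : ℂ) ^ 2) ^ m := by
  have hp := norm_ofReal_sq_lt_one hq0 hq1
  have hp0 : (q : ℂ) ^ 2 ≠ 0 := pow_ne_zero 2 (by exact_mod_cast hq0.ne')
  rcases mul_eq_zero.1 h with h | h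
  · obtain ⟨k, hk⟩ := exists_eq_of_qPochInf_eq_zero hp h
    refine ⟨k, ?_⟩
    rw [zpow_natCast]
    field_simp at hk
    linear_combination -hk
  · obtain ⟨k, hk⟩ := exists_eq_of_qPochInf_eq_zero hp h
    refine ⟨-((k + 1 : ℕ) : ℤ), ?_⟩
    rw [zpow_neg, zpow_natCast, ← mul_left_inj' (pow_ne_zero (k + 1) hp0), neg_mul,
      inv_mul_cancel₀ (pow_ne_zero _ hp0), pow_succ]
    linear_combination -hk

/-- The zeros of theta are among the points -p^m with m ∈ ℤ. A common zero would make q^{2ν} an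
integral power of q². -/
theorem lommelTheta_ne_zero_or (hq0 : 0 < q) (hq1 : q < 1) (hν : -1 < ν)
    (hνN : ∀ n : ℕ, ν ≠ (n : ℝ)) {z : ℂ} (hz : z ≠ 0) :
    lommelTheta q z ≠ 0 ∨ lommelTheta q ((((q ^ ν : ℝ) : ℂ) ^ 2)⁻¹ * z) ≠ 0 := by
  by_contra! h
  have hp0 : (q : ℂ) ^ 2 ≠ 0 := pow_ne_zero 2 (by exact_mod_cast hq0.ne')
  have hc : ((q ^ ν : ℝ) : ℂ) ^ 2 ≠ 0 :=
    pow_ne_zero 2 (by exact_mod_cast (Real.rpow_pos_of_pos hq0 ν).ne')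
  obtain ⟨m, hm⟩ := exists_zpow_of_lommelTheta_eq_zero hq0 hq1 hz h.1
  obtain ⟨m', hm'⟩ := exists_zpow_of_lommelTheta_eq_zero hq0 hq1
    (mul_ne_zero (inv_ne_zero hc) hz) h.2
  refine rpow_sq_ne_zpow hq0 hq1 hν hνN (m - m') ?_
  rw [zpow_sub₀ hp0, eq_div_iff (zpow_ne_zero _ hp0)]
  rw [hm, inv_mul_eq_iff_eq_mul₀ hc] at hm'
  linear_combination hm'

theorem one_sub_param_mul_pow_ne_zero (hq0 : 0 < q) (hq1 : q < 1) (hν : -1 < ν) (k : ℕ) :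
    1 - (q : ℂ) ^ 2 * ((q ^ ν : ℝ) : ℂ) ^ 2 * ((q : ℂ) ^ 2) ^ k ≠ 0 := by
  have h1 : q * q ^ ν < 1 := by
    rw [mul_comm, ← Real.rpow_add_one hq0.ne']
    exact Real.rpow_lt_one hq0.le hq1 (by linarith)
  have h0 : 0 < q * q ^ ν := mul_pos hq0 (Real.rpow_pos_of_pos hq0 ν)
  have h2 : (q ^ 2) ^ k ≤ 1 := pow_le_one₀ (sq_nonneg q) (by nlinarith)
  have h3 : q ^ 2 * (q ^ ν) ^ 2 < 1 := by nlinarith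
  have h4 : q ^ 2 * (q ^ ν) ^ 2 * (q ^ 2) ^ k < 1 := by
    refine lt_of_le_of_lt (mul_le_of_le_one_right (by positivity) h2) h3
  rw [sub_ne_zero]
  exact_mod_cast h4.ne'

theorem one_sub_param_inv_mul_pow_ne_zero (hq0 : 0 < q) (hq1 : q < 1) (hν : -1 < ν)
    (hνN : ∀ n : ℕ, ν ≠ (n : ℝ)) (k : ℕ) :
    1 - (q : ℂ) ^ 2 * (((q ^ ν : ℝ) : ℂ) ^ 2)⁻¹ * ((q : ℂ) ^ 2) ^ k ≠ 0 := by
  have hc : ((q ^ ν : ℝ) : ℂ) ^ 2 ≠ 0 :=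
    pow_ne_zero 2 (by exact_mod_cast (Real.rpow_pos_of_pos hq0 ν).ne')
  intro h
  refine rpow_sq_ne_zpow hq0 hq1 hν hνN ((k + 1 : ℕ) : ℤ) ?_
  rw [zpow_natCast, pow_succ]
  linear_combination ((q ^ ν : ℝ) : ℂ) ^ 2 * h +
    (q : ℂ) ^ 2 * ((q : ℂ) ^ 2) ^ k * mul_inv_cancel₀ hc

theorem lommelDenom_eq (hq0 : 0 < q) (ν : ℝ) (s : ℂ) :
    lommelDenom q ν (s ^ 2) s =
      (((q ^ ν : ℝ) : ℂ) ^ 2)⁻¹ * qBesselSeries q ((q : ℂ) ^ 2 * (((q ^ ν : ℝ) : ℂ) ^ 2)⁻¹)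
          ((q : ℂ) ^ 2 * ((((q ^ ν : ℝ) : ℂ) ^ 2)⁻¹ * s ^ 2)) * lommelTheta q (s ^ 2) -
        qPochInf ((q : ℂ) ^ 2 * ((q ^ ν : ℝ) : ℂ) ^ 2) ((q : ℂ) ^ 2) /
          qPochInf ((q : ℂ) ^ 2 * (((q ^ ν : ℝ) : ℂ) ^ 2)⁻¹) ((q : ℂ) ^ 2) *
          qBesselSeries q ((q : ℂ) ^ 2 * ((q ^ ν : ℝ) : ℂ) ^ 2) ((q : ℂ) ^ 2 * s ^ 2) *
          lommelTheta q ((((q ^ ν : ℝ) : ℂ) ^ 2)⁻¹ * s ^ 2) := by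
  have e1 : ((q ^ (2 * ν) : ℝ) : ℂ) = ((q ^ ν : ℝ) : ℂ) ^ 2 := by
    rw [rpow_two_mul_exponent hq0, Complex.ofReal_pow]
  have e2 : ((q ^ (-2 * ν) : ℝ) : ℂ) = (((q ^ ν : ℝ) : ℂ) ^ 2)⁻¹ := by
    rw [neg_mul, Real.rpow_neg hq0.le, Complex.ofReal_inv, e1]
  have e3 : ((q ^ (2 * ν + 2) : ℝ) : ℂ) = (q : ℂ) ^ 2 * ((q ^ ν : ℝ) : ℂ) ^ 2 := by
    rw [Real.rpow_add hq0, Complex.ofReal_mul, e1, Real.rpow_two, Complex.ofReal_pow, mul_comm]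
  have e4 : ((q ^ (-2 * ν + 2) : ℝ) : ℂ) = (q : ℂ) ^ 2 * (((q ^ ν : ℝ) : ℂ) ^ 2)⁻¹ := by
    rw [Real.rpow_add hq0, Complex.ofReal_mul, e2, Real.rpow_two, Complex.ofReal_pow, mul_comm]
  have e5 : ((q ^ (2 - 2 * ν) : ℝ) : ℂ) = (q : ℂ) ^ 2 * (((q ^ ν : ℝ) : ℂ) ^ 2)⁻¹ := by
    rw [← e4]; ring_nf
  have e6 : (((q ^ (1 - ν) : ℝ) : ℂ) * s) ^ 2 =
      (q : ℂ) ^ 2 * ((((q ^ ν : ℝ) : ℂ) ^ 2)⁻¹ * s ^ 2) := by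
    rw [Real.rpow_sub hq0, Real.rpow_one, Complex.ofReal_div, mul_pow, div_pow, div_eq_mul_inv,
      mul_assoc]
  have e7 : ((q ^ (-ν) : ℝ) : ℂ) ^ 2 = (((q ^ ν : ℝ) : ℂ) ^ 2)⁻¹ := by
    rw [Real.rpow_neg hq0.le, Complex.ofReal_inv, inv_pow]
  rw [lommelDenom, lommelSigma, e1, e2, e3, e4, e5, qBesselI_eq_qBesselSeries hq0,
    qBesselI_eq_qBesselSeries hq0, e6, e7, mul_pow]
  simp only [lommelTheta, mul_inv, inv_inv, mul_assoc]

theorem lommelStieltjes_eq (hq0 : 0 < q) (ν : ℝ) (s : ℂ) :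
    lommelStieltjes q ν (s ^ 2) s =
      1 / (((q ^ ν : ℝ) : ℂ) ^ 2 *
        qBesselSeries q ((q : ℂ) ^ 2 * ((q ^ ν : ℝ) : ℂ) ^ 2) ((q : ℂ) ^ 2 * s ^ 2)) *
      (qBesselSeries q ((q : ℂ) ^ 2 * ((q ^ ν : ℝ) : ℂ) ^ 2) (s ^ 2) -
        ((((q ^ ν : ℝ) : ℂ) ^ 2)⁻¹ - 1) * lommelTheta q (s ^ 2) / lommelDenom q ν (s ^ 2) s) := by
  have e1 : ((q ^ (2 * ν) : ℝ) : ℂ) = ((q ^ ν : ℝ) : ℂ) ^ 2 := by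
    rw [rpow_two_mul_exponent hq0, Complex.ofReal_pow]
  have e2 : ((q ^ (-2 * ν) : ℝ) : ℂ) = (((q ^ ν : ℝ) : ℂ) ^ 2)⁻¹ := by
    rw [neg_mul, Real.rpow_neg hq0.le, Complex.ofReal_inv, e1]
  rw [lommelStieltjes, e1, e2, qBesselI_eq_qBesselSeries hq0, qBesselI_eq_qBesselSeries hq0,
    mul_pow]

end Identification

/-! ### The closed form and its removable singularities -/

theorem IsLommelOrthogonalityMeasure.stieltjes_eq {q ν : ℝ} (hq0 : 0 < q) (hq1 : q < 1)
    (hν : -1 < ν) (hνN : ∀ n : ℕ, ν ≠ (n : ℝ)) {μ : Measure ℝ}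
    (h : IsLommelOrthogonalityMeasure q ν μ) {s : ℂ}
    (hz : s ^ 2 ∉ (fun t : ℝ => (t : ℂ)) '' μ.support) :
    lommelDenom q ν (s ^ 2) s ≠ 0 ∧
      (qBesselI ν (q ^ 2) ((q : ℂ) * s) ≠ 0 →
        ∫ t : ℝ, 1 / (s ^ 2 - (t : ℂ)) ∂μ = lommelStieltjes q ν (s ^ 2) s) := by
  obtain ⟨δ, hδ, hle⟩ := exists_pos_le_norm_sub_of_notMem_support hz
  have hz0 : s ^ 2 ≠ 0 := fun h0 => hz (h0 ▸ h.zero_mem_support hq0 hq1)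
  set c : ℂ := ((q ^ ν : ℝ) : ℂ) with hcdef
  have hqc : (q : ℂ) ≠ 0 := by exact_mod_cast hq0.ne'
  have hc : c ≠ 0 := Complex.ofReal_ne_zero.2 (Real.rpow_pos_of_pos hq0 ν).ne'
  have hd1 : c ^ 2 ≠ 1 := by simpa only [zpow_zero] using rpow_sq_ne_zpow hq0 hq1 hν hνN 0
  have hA : ∀ n, (lommelA q ν n : ℂ) = (q : ℂ) ^ (2 * n) * (q * c) := fun n => by
    rw [lommelA_eq hq0]; push_cast; ring
  have hB : ∀ n, (lommelB q ν n : ℂ) = -((q : ℂ) ^ (2 * n) * (1 + c ^ 2)) := fun n => by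
    rw [lommelB_eq hq0]; push_cast; rfl
  -- Index shift by one: the value q/c stands for φ_{-1}. As a_{-1} = c/q, it absorbs the
  -- inhomogeneous term 1 of the first equation.
  let Φ : ℕ → ℂ := fun n => Nat.casesOn n (q / c) (lommelPhi q ν μ (s ^ 2))
  have hΦ : ∀ n, ((q : ℂ) ^ (2 * n) * (q * c)) * Φ (n + 2) + ((q : ℂ) ^ (2 * n) * (c / q)) * Φ n =
      (s ^ 2 + (q : ℂ) ^ (2 * n) * (1 + c ^ 2)) * Φ (n + 1) := by
    intro n
    cases n with
    | zero =>
      have h1 := lommelPhi_rec_zero hq0 h hδ hle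
      have h2 : c / q * (q / c) = 1 := by field_simp
      rw [hA, hB] at h1
      change (q : ℂ) ^ (2 * 0) * (q * c) * lommelPhi q ν μ (s ^ 2) 1 +
        (q : ℂ) ^ (2 * 0) * (c / q) * (q / c) =
        (s ^ 2 + (q : ℂ) ^ (2 * 0) * (1 + c ^ 2)) * lommelPhi q ν μ (s ^ 2) 0
      linear_combination h1 + h2
    | succ n =>
      have h1 := lommelPhi_rec_succ hq0 h hδ hle n
      have h2 : (q : ℂ) ^ (2 * (n + 1)) * (c / q) = (q : ℂ) ^ (2 * n) * (q * c) := by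
        field_simp; ring
      rw [hA, hA, hB] at h1
      simp only [Φ]
      linear_combination h1 + lommelPhi q ν μ (s ^ 2) n * h2
  obtain ⟨hD, hform⟩ := bounded_lommel_solution hq0 hq1 hc hd1
    (one_sub_param_mul_pow_ne_zero hq0 hq1 hν)
    (one_sub_param_inv_mul_pow_ne_zero hq0 hq1 hν hνN) hz0
    (lommelTheta_ne_zero_or hq0 hq1 hν hνN hz0) (Φ := Φ) rfl hΦ (h.norm_lommelPhi_le hδ hle) rfl
    (lommelDenom_eq hq0 ν s)
  refine ⟨hD, fun hI => ?_⟩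
  rw [qBesselI_eq_qBesselSeries hq0, mul_pow, ← hcdef] at hI
  have hφ : Φ 1 = ∫ t : ℝ, 1 / (s ^ 2 - (t : ℂ)) ∂μ := by
    simp [Φ, lommelPhi, lommelP]
  rw [← hφ, lommelStieltjes_eq hq0]
  have hne := mul_ne_zero (pow_ne_zero 2 hc) hI
  rw [one_div, eq_inv_mul_iff_mul_eq₀ hne, eq_sub_iff_add_eq]
  refine mul_right_cancel₀ hD ?_
  rw [add_mul, div_mul_cancel₀ _ hD]
  linear_combination hform

/-- An entire function with value 1 at 0 has isolated zeros. -/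
theorem eventually_qBesselI_ne_zero {q ν : ℝ} (hq0 : 0 < q) (hq1 : q < 1) (hν : -1 < ν) (s : ℂ) :
    ∀ᶠ w in 𝓝[≠] s, qBesselI ν (q ^ 2) ((q : ℂ) * w) ≠ 0 := by
  have hF := differentiable_qBesselSeries hq0 hq1 (one_sub_param_mul_pow_ne_zero hq0 hq1 hν)
  have hd : Differentiable ℂ fun w : ℂ => qBesselI ν (q ^ 2) ((q : ℂ) * w) := by
    simp only [qBesselI_eq_qBesselSeries hq0]
    fun_prop
  have ha : AnalyticOnNhd ℂ (fun w : ℂ => qBesselI ν (q ^ 2) ((q : ℂ) * w)) Set.univ :=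
    fun w _ => hd.analyticAt w
  by_contra hfreq
  have h0 := ha.eqOn_zero_of_preconnected_of_frequently_eq_zero isPreconnected_univ
    (Set.mem_univ s) hfreq (Set.mem_univ 0)
  change qBesselI ν (q ^ 2) ((q : ℂ) * 0) = 0 at h0
  rw [mul_zero, qBesselI_eq_qBesselSeries hq0, zero_pow two_ne_zero, qBesselSeries_zero] at h0
  exact one_ne_zero h0

theorem mainTheorem1 (q ν : ℝ) (hq0 : 0 < q) (hq1 : q < 1) (hν : -1 < ν)
    (hνN : ∀ n : ℕ, ν ≠ (n : ℝ)) :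
    (∃! μ : Measure ℝ, IsLommelOrthogonalityMeasure q ν μ) ∧
    ∀ μ : Measure ℝ, IsLommelOrthogonalityMeasure q ν μ →
      ∀ z : ℂ, z ∉ (fun t : ℝ => (t : ℂ)) '' μ.support →
        Integrable (fun t : ℝ => 1 / (z - (t : ℂ))) μ ∧
        ∀ s : ℂ, s ^ 2 = z →
          lommelDenom q ν z s ≠ 0 ∧
          (qBesselI ν (q ^ 2) ((q : ℂ) * s) ≠ 0 →
            ∫ t : ℝ, 1 / (z - (t : ℂ)) ∂μ = lommelStieltjes q ν z s) ∧
          Tendsto (fun w : ℂ => lommelStieltjes q ν (w ^ 2) w) (𝓝[≠] s)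
            (𝓝 (∫ t : ℝ, 1 / (z - (t : ℂ)) ∂μ)) := by
  refine ⟨existsUnique_lommel_measure hq0 hq1 ν, fun μ hμ z hz => ⟨?_, ?_⟩⟩
  · obtain ⟨δ, hδ, hle⟩ := exists_pos_le_norm_sub_of_notMem_support hz
    have := IsLommelOrthogonalityMeasure.integrable_mul_inv_sub hδ hle (hμ.integrable_lommelP 0)
    simpa [lommelP] using this
  · rintro s rfl
    obtain ⟨h1, h2⟩ := hμ.stieltjes_eq hq0 hq1 hν hνN hz
    refine ⟨h1, h2, ?_⟩
    have := hμ.isProbabilityMeasure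
    have hcl : IsClosed ((fun t : ℝ => (t : ℂ)) '' μ.support) :=
      Complex.isometry_ofReal.isClosedEmbedding.isClosedMap _ Measure.isClosed_support
    have hsq : Tendsto (fun w : ℂ => w ^ 2) (𝓝[≠] s) (𝓝 (s ^ 2)) :=
      ((continuous_pow 2).tendsto s).mono_left nhdsWithin_le_nhds
    -- Near s, off s itself, the closed form equals the transform, which is continuous at s².
    refine ((IsLommelOrthogonalityMeasure.continuousAt_stieltjes hz).tendsto.comp hsq).congr' ?_
    filter_upwards [eventually_qBesselI_ne_zero hq0 hq1 hν s,
      hsq (hcl.isOpen_compl.mem_nhds hz)] with w hw hwz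
    exact (hμ.stieltjes_eq hq0 hq1 hν hνN hwz).2 hw
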